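/- **Conventions.** For a linear connection $D$ on a pseudo-Riemannian manifold $(N,g)$ put $R(X,Y)Z=D_XD_YZ-D_YD_XZ-D_{[X,Y]}Z$, $\;\mathrm{Ric}(X,Y)=\sum_k\varepsilon_k\,g(R(X,E_k)Y,E_k)$ and scalar curvature $\sum_k\varepsilon_k\,\mathrm{Ric}(E_k,E_k)$, where $(E_k)$ is an orthonormal basis with $g(E_k,E_k)=\varepsilon_k=\pm1$. **Theorem 3.19.** Let $I\subseteq\mathbb R$ be a nonempty open interval, $(F,g_F)$ a nonempty smooth pseudo-Riemannian manifold of dimension $3$, $f:I\to(0,\infty)$ smooth, and $M=I\times F$ with the metric $g=-dt^2+f(t)^2g_F$. Let $\lambda_1,\lambda_2\in\mathbb R$, let $P=\partial/\partial t$, $\pi(X)=g(X,P)$, and let $\overline\nabla$ be the connection $$\overline\nabla_XY=\nabla_XY+\lambda_1\pi(Y)X-\lambda_2\,g(X,Y)P,$$ where $\nabla$ is the Levi-Civita connection of $(M,g)$. Let $\overline S$ be a real number and put $v=f^2$. Then $(M,\overline\nabla)$ has constant scalar curvature $\overline S$ if and only if $F$, with its Levi-Civita connection, has constant scalar curvature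 $S^F$ for some $S^F\in\mathbb R$ and one of the following holds for some real constants $c_1,c_2$ and all $t\in I$: 1. $\overline S<\frac{27}{16}(\lambda_1+\lambda_2)^2+3\lambda_1^2+3\lambda_2^2-12\lambda_1\lambda_2$, $\;\overline S\ne3\lambda_1^2+3\lambda_2^2-12\lambda_1\lambda_2$, and $$v(t)=c_1e^{\frac12\left(\frac32(\lambda_1+\lambda_2)+\sqrt{D}\right)t}+c_2e^{\frac12\left(\frac32(\lambda_1+\lambda_2)-\sqrt{D}\right)t}+\frac{S^F}{12\lambda_1\lambda_2-3\lambda_1^2-3\lambda_2^2+\overline S},$$ with $D=\frac94(\lambda_1+\lambda_2)^2-\frac43\overline S+4\lambda_1^2+4\lambda_2^2-16\lambda_1\lambda_2$; 2. $\overline S=\frac{27}{16}(\lambda_1+\lambda_2)^2+3\lambda_1^2+3\lambda_2^2-12\lambda_1\lambda_2$, $\;\overline S\ne3\lambda_1^2+3\lambda_2^2-12\lambda_1\lambda_2$, and $$v(t)=c_1e^{\frac34(\lambda_1+\lambda_2)t}+c_2te^{\frac34(\lambda_1+\lambda_2)t}+\frac{S^F}{12\lambda_1\lambda_2-3\lambda_1^2-3\lambda_2^2+\overline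 S};$$ 3. $\overline S>\frac{27}{16}(\lambda_1+\lambda_2)^2+3\lambda_1^2+3\lambda_2^2-12\lambda_1\lambda_2$, and $$v(t)=c_1e^{\frac34(\lambda_1+\lambda_2)t}\cos\left(\tfrac12\sqrt{D'}\,t\right)+c_2e^{\frac34(\lambda_1+\lambda_2)t}\sin\left(\tfrac12\sqrt{D'}\,t\right)+\frac{S^F}{12\lambda_1\lambda_2-3\lambda_1^2-3\lambda_2^2+\overline S},$$ with $D'=\frac43\overline S-4\lambda_1^2-4\lambda_2^2+16\lambda_1\lambda_2-\frac94(\lambda_1+\lambda_2)^2$; 4. $\overline S=3\lambda_1^2+3\lambda_2^2-12\lambda_1\lambda_2$, $\;\lambda_1+\lambda_2\ne0$, and $$v(t)=c_1-\frac{2S^F}{9(\lambda_1+\lambda_2)}\,t+c_2e^{\frac32(\lambda_1+\lambda_2)t};$$ 5. $\overline S=3\lambda_1^2+3\lambda_2^2-12\lambda_1\lambda_2$, $\;\lambda_1+\lambda_2=0$, and $$v(t)=\frac{S^F}{6}t^2+c_1t+c_2.$$ -/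

import Mathlib

set_option maxSynthPendingDepth 3

open scoped Manifold ContDiff

noncomputable section

/-!
Pseudo-Riemannian metrics, the connection
`X, Y ↦ ∇_X Y + lam₁ π(Y) X - lam₂ g(X, Y) P`, and scalar curvature. Curvature at a point is computed
by the classical coordinate formulas in the preferred chart at that point, as Mathlib does for
`mfderiv` and for the Lie bracket of vector fields; the result does not depend on the chart.
-/

section LocalGeometry

/-! ### Geometry on an open piece of a vector space

`G` is a metric, given by its values `G y u v` for `y` in (an open subset of) `E`. A connection is
given by its Christoffel map `Γ`: it is `(∇_X Y)(y) = DY(y)(X y) + Γ y (X y) (Y y)`. -/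

variable {E : Type*} [NormedAddCommGroup E] [NormedSpace ℝ E]

/-- The Christoffel symbols of the first kind,
`(u, v, w) ↦ (D_u G(v, w) + D_v G(u, w) - D_w G(u, v)) / 2`. -/
def christoffelFirstKind (G : E → E →L[ℝ] E →L[ℝ] ℝ) (y : E) : E →L[ℝ] E →L[ℝ] E →L[ℝ] ℝ :=
  let D₁ : E →L[ℝ] E →L[ℝ] E →L[ℝ] ℝ := fderiv ℝ G y
  let D₂ : E →L[ℝ] E →L[ℝ] E →L[ℝ] ℝ := D₁.flip
  let swap : (E →L[ℝ] E →L[ℝ] ℝ) →L[ℝ] E →L[ℝ] E →L[ℝ] ℝ :=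
    (ContinuousLinearMap.flipₗᵢ ℝ E E ℝ).toContinuousLinearEquiv
  (1 / 2 : ℝ) • (D₁ + D₂ - swap.comp D₂)

/-- The Christoffel map of the Levi-Civita connection: `Γ y u v` is the vector with
`G y (Γ y u v) w = christoffelFirstKind G y u v w` for all `w`.
Here `(G y).inverse` turns a covector into a vector by means of the metric. -/
def leviCivitaChristoffel (G : E → E →L[ℝ] E →L[ℝ] ℝ) (y : E) : E →L[ℝ] E →L[ℝ] E :=
  (ContinuousLinearMap.compL ℝ E (E →L[ℝ] ℝ) E (G y).inverse).comp (christoffelFirstKind G y)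

/-- The Christoffel map of the connection `X, Y ↦ ∇_X Y + lam₁ π(Y) X - lam₂ G(X, Y) P`, with `∇`
the Levi-Civita connection and `π(Y) = G(Y, P)`. -/
def quarterSymmetricChristoffel (lam₁ lam₂ : ℝ) (G : E → E →L[ℝ] E →L[ℝ] ℝ) (P : E → E) (y : E) :
    E →L[ℝ] E →L[ℝ] E :=
  leviCivitaChristoffel G y
    + lam₁ • ContinuousLinearMap.smulRightL ℝ E E ((G y).flip (P y))
    - lam₂ • ((ContinuousLinearMap.smulRightL ℝ E E).flip (P y)).comp (G y)

/-- The curvature `R(u, w) v` of a connection, for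
`R(X, Y) Z = ∇_X ∇_Y Z - ∇_Y ∇_X Z - ∇_[X,Y] Z`; it is obtained by inserting the constant
fields `X = u`, `Y = w`, `Z = v`. -/
def localCurvature (Γ : E → E →L[ℝ] E →L[ℝ] E) (y u w v : E) : E :=
  fderiv ℝ Γ y u w v - fderiv ℝ Γ y w u v + Γ y u (Γ y w v) - Γ y w (Γ y u v)

/-- The Ricci tensor `Ric(u, v) = tr (w ↦ R(u, w) v)`, that is `∑ₖ εₖ ⟨R(u, Eₖ) v, Eₖ⟩` in
an orthonormal basis. -/
def localRicci (Γ : E → E →L[ℝ] E →L[ℝ] E) (y : E) : E →ₗ[ℝ] E →ₗ[ℝ] ℝ :=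
  LinearMap.mk₂ ℝ
    (fun u v ↦ LinearMap.trace ℝ E
      { toFun := fun w ↦ localCurvature Γ y u w v
        map_add' := fun w w' ↦ by simp [localCurvature]; abel
        map_smul' := fun c w ↦ by simp [localCurvature, smul_sub, smul_add] })
    (fun u u' v ↦ by
      rw [← map_add]; congr 1; ext w; simp [localCurvature]; abel)
    (fun c u v ↦ by
      rw [← map_smul]; congr 1; ext w; simp [localCurvature, smul_sub, smul_add])
    (fun u v v' ↦ by
      rw [← map_add]; congr 1; ext w; simp [localCurvature]; abel)
    (fun c u v ↦ by
      rw [← map_smul]; congr 1; ext w; simp [localCurvature, smul_sub, smul_add])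

/-- The scalar curvature: the trace of the Ricci tensor with respect to the metric, that is
`∑ₖ εₖ Ric(Eₖ, Eₖ)` in an orthonormal basis. -/
def localScalarCurvature [FiniteDimensional ℝ E] (G : E → E →L[ℝ] E →L[ℝ] ℝ)
    (Γ : E → E →L[ℝ] E →L[ℝ] E) (y : E) : ℝ :=
  LinearMap.trace ℝ E (((G y).inverse : (E →L[ℝ] ℝ) →ₗ[ℝ] E) ∘ₗ
    (LinearMap.toContinuousLinearMap : (E →ₗ[ℝ] ℝ) ≃ₗ[ℝ] (E →L[ℝ] ℝ)).toLinearMap ∘ₗ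
    localRicci Γ y)

end LocalGeometry

section Manifold

variable {E : Type*} [NormedAddCommGroup E] [NormedSpace ℝ E]
  {H : Type*} [TopologicalSpace H] (I : ModelWithCorners ℝ E H)
  {M : Type*} [TopologicalSpace M] [ChartedSpace H M]

/-- `g` is a smooth pseudo-Riemannian metric: a smooth field of nondegenerate symmetric bilinear
forms on the tangent spaces. -/
structure IsPseudoRiemannianMetric [IsManifold I ∞ M]
    (g : ∀ x : M, TangentSpace I x →L[ℝ] TangentSpace I x →L[ℝ] ℝ) : Prop where
  symm : ∀ (x : M) (v w : TangentSpace I x), g x v w = g x w v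
  nondegenerate : ∀ (x : M) (v : TangentSpace I x), (∀ w, g x v w = 0) → v = 0
  contMDiff : ContMDiff I (I.prod 𝓘(ℝ, E →L[ℝ] E →L[ℝ] ℝ)) ∞
    (fun x ↦ Bundle.TotalSpace.mk' (E →L[ℝ] E →L[ℝ] ℝ) x (g x))

/-- The metric `g` in the preferred chart at `p`: the pullback of `g` under the inverse chart. -/
def metricInChart (g : ∀ x : M, TangentSpace I x →L[ℝ] TangentSpace I x →L[ℝ] ℝ) (p : M) (y : E) :
    E →L[ℝ] E →L[ℝ] ℝ :=
  let φ := extChartAt I p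
  let h : E →L[ℝ] E →L[ℝ] ℝ := g (φ.symm y)
  let A : E →L[ℝ] E := mfderivWithin 𝓘(ℝ, E) I φ.symm (Set.range I) y
  h.bilinearComp A A

/-- The vector field `P` in the preferred chart at `p`. -/
def vectorFieldInChart (P : ∀ x : M, TangentSpace I x) (p : M) (y : E) : E :=
  VectorField.mpullbackWithin 𝓘(ℝ, E) I (extChartAt I p).symm P (Set.range I) y

variable [FiniteDimensional ℝ E]

/-- The scalar curvature at `p` of the Levi-Civita connection of `g`. -/
def scalarCurvature (g : ∀ x : M, TangentSpace I x →L[ℝ] TangentSpace I x →L[ℝ] ℝ) (p : M) : ℝ :=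
  localScalarCurvature (metricInChart I g p) (leviCivitaChristoffel (metricInChart I g p))
    (extChartAt I p p)

/-- The scalar curvature at `p` of the quarter-symmetric connection
`X, Y ↦ ∇_X Y + lam₁ π(Y) X - lam₂ g(X, Y) P`, where `π(Y) = g(Y, P)`. -/
def quarterSymmetricScalarCurvature (lam₁ lam₂ : ℝ)
    (g : ∀ x : M, TangentSpace I x →L[ℝ] TangentSpace I x →L[ℝ] ℝ)
    (P : ∀ x : M, TangentSpace I x) (p : M) : ℝ :=
  localScalarCurvature (metricInChart I g p)
    (quarterSymmetricChristoffel lam₁ lam₂ (metricInChart I g p) (vectorFieldInChart I P p))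
    (extChartAt I p p)

end Manifold

section WarpedProduct

variable {E : Type*} [NormedAddCommGroup E] [NormedSpace ℝ E]
  {H : Type*} [TopologicalSpace H] (J : ModelWithCorners ℝ E H)
  {F : Type*} [TopologicalSpace F] [ChartedSpace H F]

/-- The metric `-dt² + f(t)² g_F` on `I × F`. -/
def warpedMetric (I : TopologicalSpace.Opens ℝ) (f : ℝ → ℝ)
    (gF : ∀ x : F, TangentSpace J x →L[ℝ] TangentSpace J x →L[ℝ] ℝ) (p : I × F) :
    TangentSpace (𝓘(ℝ, ℝ).prod J) p →L[ℝ] TangentSpace (𝓘(ℝ, ℝ).prod J) p →L[ℝ] ℝ :=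
  let dt : ℝ × E →L[ℝ] ℝ := ContinuousLinearMap.fst ℝ ℝ E
  let dx : ℝ × E →L[ℝ] E := ContinuousLinearMap.snd ℝ ℝ E
  let h : E →L[ℝ] E →L[ℝ] ℝ := gF p.2
  (-(ContinuousLinearMap.mul ℝ ℝ).bilinearComp dt dt + (f p.1) ^ 2 • h.bilinearComp dx dx :
    ℝ × E →L[ℝ] ℝ × E →L[ℝ] ℝ)

/-- The vector field `∂/∂t` on `I × F`. -/
def timeField (I : TopologicalSpace.Opens ℝ) (p : I × F) : TangentSpace (𝓘(ℝ, ℝ).prod J) p :=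
  ((1, 0) : ℝ × E)

end WarpedProduct

end

/-! The chart of `I × F` at a point is the inclusion of `I` times a chart of `F`, so the curvature
can be computed for `-dt² + f² H` on an open subset of `ℝ × E`. There the Christoffel map of the
connection is that of `H` plus a few terms whose coefficients depend on `t` only. Taking curvature,
Ricci trace and metric trace gives, with `v = f²`, `L = lam₁ + lam₂` and `κ = 3 lam₁² + 3 lam₂² - 12
lam₁ lam₂`, the identity `v · S̄ = S^F - 3 v'' + (9/2) L v' + κ v`
(`sq_mul_quarterSymmetricScalarCurvature_warpedMetric`). Linearity in `v` is special to fibre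
dimension `n = 3`: the terms `n(n-1) f'² + 2n f f''` are then `3 v''`.

If `S̄` is constant, comparing two points of `F` at the same time shows that `S^F` is constant. What
remains is `v'' = (3/2) L v' - (S̄ - κ)/3 v + S^F/3`, with constant coefficients
(`warping_ode_iff`). The sign of the discriminant `(9/4) L² - (4/3)(S̄ - κ)` gives the cases 1 to 3,
with particular solution `S^F/(S̄ - κ)`. For `S̄ = κ` constants solve the homogeneous equation, and
the particular solution becomes linear (`L ≠ 0`) or quadratic (`L = 0`). Completeness of each list
of solutions follows from Wronskians. -/

noncomputable section

/-! ### Linear second-order equations with constant coefficients. -/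

section SecondOrderODE

/-- `y` solves the linear equation `y'' = p y' - q y + r` on `s`, with first derivative `y'`. -/
structure SolvesLinearODE (p q r : ℝ) (s : Set ℝ) (y y' : ℝ → ℝ) : Prop where
  hasDerivAt : ∀ t ∈ s, HasDerivAt y (y' t) t
  hasDerivAt_deriv : ∀ t ∈ s, HasDerivAt y' (p * y' t - q * y t + r) t

namespace SolvesLinearODE

variable {p q r : ℝ} {s : Set ℝ} {y y' z z' w w' : ℝ → ℝ}

/-- Abel's identity. -/
theorem exists_wronskian_eq (hs : IsOpen s) (hs' : IsPreconnected s)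
    (hy : SolvesLinearODE p q 0 s y y') (hz : SolvesLinearODE p q 0 s z z') :
    ∃ c : ℝ, ∀ t ∈ s, y t * z' t - y' t * z t = c * Real.exp (p * t) := by
  -- The Wronskian `W` satisfies `W' = p W`; multiplying by the integrating factor `exp (-p t)`
  -- makes it constant.
  have key : ∀ t ∈ s, HasDerivAt (fun t ↦ (y t * z' t - y' t * z t) * Real.exp (-(p * t))) 0 t := by
    intro t ht
    have h := (((hy.hasDerivAt t ht).mul (hz.hasDerivAt_deriv t ht)).sub
      ((hy.hasDerivAt_deriv t ht).mul (hz.hasDerivAt t ht))).mul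
      (((hasDerivAt_id t).const_mul p).neg.exp)
    refine h.congr_deriv ?_
    simp
    ring
  obtain ⟨c, hc⟩ := hs.exists_is_const_of_deriv_eq_zero hs'
    (fun t ht ↦ (key t ht).differentiableAt.differentiableWithinAt)
    (fun t ht ↦ (key t ht).deriv)
  refine ⟨c, fun t ht ↦ ?_⟩
  rw [← hc t ht, mul_assoc, ← Real.exp_add]
  simp

/-- The identity `w W(y, z) = y W(w, z) + z W(y, w)` holds pointwise. By Abel the three Wronskians
are constant multiples of the same exponential, so the coefficients are ratios of these constants,
and no uniqueness theorem for initial values is needed. -/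
theorem exists_eq_linear_combination (hs : IsOpen s) (hs' : IsPreconnected s)
    (hne : s.Nonempty)
    (hy : SolvesLinearODE p q 0 s y y') (hz : SolvesLinearODE p q 0 s z z')
    (hw : SolvesLinearODE p q 0 s w w') (hW : ∀ t, y t * z' t - y' t * z t ≠ 0) :
    ∃ c₁ c₂ : ℝ, ∀ t ∈ s, w t = c₁ * y t + c₂ * z t := by
  obtain ⟨k, hk⟩ := exists_wronskian_eq hs hs' hy hz
  obtain ⟨k₁, hk₁⟩ := exists_wronskian_eq hs hs' hw hz
  obtain ⟨k₂, hk₂⟩ := exists_wronskian_eq hs hs' hy hw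
  have hk0 : k ≠ 0 := by
    rintro rfl
    obtain ⟨t, ht⟩ := hne
    exact hW t (by rw [hk t ht, zero_mul])
  refine ⟨k₁ / k, k₂ / k, fun t ht ↦ ?_⟩
  have hexp := (Real.exp_pos (p * t)).ne'
  field_simp
  apply mul_right_cancel₀ hexp
  linear_combination (-w t) * hk t ht + y t * hk₁ t ht + z t * hk₂ t ht

theorem mono {s' : Set ℝ} (h : SolvesLinearODE p q r s y y') (hs : s' ⊆ s) :
    SolvesLinearODE p q r s' y y' :=
  ⟨fun t ht ↦ h.1 t (hs ht), fun t ht ↦ h.2 t (hs ht)⟩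

theorem sub (hy : SolvesLinearODE p q r s y y') (hz : SolvesLinearODE p q r s z z') :
    SolvesLinearODE p q 0 s (fun t ↦ y t - z t) (fun t ↦ y' t - z' t) :=
  ⟨fun t ht ↦ (hy.1 t ht).sub (hz.1 t ht),
    fun t ht ↦ ((hy.2 t ht).sub (hz.2 t ht)).congr_deriv (by ring)⟩

theorem linear_combination_add (hy : SolvesLinearODE p q 0 s y y')
    (hz : SolvesLinearODE p q 0 s z z') (hw : SolvesLinearODE p q r s w w') (c₁ c₂ : ℝ) :
    SolvesLinearODE p q r s (fun t ↦ c₁ * y t + c₂ * z t + w t)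
      (fun t ↦ c₁ * y' t + c₂ * z' t + w' t) :=
  ⟨fun t ht ↦ (((hy.1 t ht).const_mul c₁).add ((hz.1 t ht).const_mul c₂)).add (hw.1 t ht),
    fun t ht ↦ ((((hy.2 t ht).const_mul c₁).add ((hz.2 t ht).const_mul c₂)).add
      (hw.2 t ht)).congr_deriv (by ring)⟩

end SolvesLinearODE

/-- The general solution of a linear equation of second order with constant coefficients, in terms
of a fundamental system `y`, `z` and a particular solution `w`. -/
theorem forall_deriv_eq_iff_exists_eq {p q r : ℝ} {s : Set ℝ} {y y' z z' w w' v v' v'' : ℝ → ℝ}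
    (hs : IsOpen s) (hs' : IsPreconnected s) (hne : s.Nonempty)
    (hv : ∀ t ∈ s, HasDerivAt v (v' t) t) (hv' : ∀ t ∈ s, HasDerivAt v' (v'' t) t)
    (hy : SolvesLinearODE p q 0 Set.univ y y') (hz : SolvesLinearODE p q 0 Set.univ z z')
    (hw : SolvesLinearODE p q r Set.univ w w') (hW : ∀ t, y t * z' t - y' t * z t ≠ 0) :
    (∀ t ∈ s, v'' t = p * v' t - q * v t + r) ↔
      ∃ c₁ c₂ : ℝ, ∀ t ∈ s, v t = c₁ * y t + c₂ * z t + w t := by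
  constructor
  · intro h
    have hv : SolvesLinearODE p q r s v v' := ⟨hv, fun t ht ↦ h t ht ▸ hv' t ht⟩
    obtain ⟨c₁, c₂, hc⟩ := SolvesLinearODE.exists_eq_linear_combination hs hs' hne
      (hy.mono (Set.subset_univ s)) (hz.mono (Set.subset_univ s))
      (hv.sub (hw.mono (Set.subset_univ s))) hW
    exact ⟨c₁, c₂, fun t ht ↦ by rw [← hc t ht]; ring⟩
  · rintro ⟨c₁, c₂, h⟩ t ht
    have hu := hy.linear_combination_add hz hw c₁ c₂
    -- Since `s` is open, the formula for `v` may be differentiated, twice, at each of its points.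
    have h' : ∀ t ∈ s, v' t = c₁ * y' t + c₂ * z' t + w' t := fun t ht ↦
      (hv t ht).unique ((hu.1 t (Set.mem_univ t)).congr_of_eventuallyEq
        (Filter.eventually_of_mem (hs.mem_nhds ht) h))
    have h'' := (hv' t ht).unique ((hu.2 t (Set.mem_univ t)).congr_of_eventuallyEq
        (Filter.eventually_of_mem (hs.mem_nhds ht) h'))
    rw [h'', ← h t ht, ← h' t ht]

theorem solvesLinearODE_exp {p q k : ℝ} (hk : k ^ 2 = p * k - q) :
    SolvesLinearODE p q 0 Set.univ (fun t ↦ Real.exp (k * t)) (fun t ↦ k * Real.exp (k * t)) := by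
  have h (t : ℝ) : HasDerivAt (fun t ↦ Real.exp (k * t)) (k * Real.exp (k * t)) t := by
    simpa [mul_comm] using ((hasDerivAt_id t).const_mul k).exp
  refine ⟨fun t _ ↦ h t, fun t _ ↦ ((h t).const_mul k).congr_deriv ?_⟩
  linear_combination Real.exp (k * t) * hk

/-- Second solution for a double characteristic root `k`. -/
theorem solvesLinearODE_mul_exp (k : ℝ) :
    SolvesLinearODE (2 * k) (k ^ 2) 0 Set.univ (fun t ↦ t * Real.exp (k * t))
      (fun t ↦ (1 + k * t) * Real.exp (k * t)) := by
  have h (t : ℝ) : HasDerivAt (fun t ↦ Real.exp (k * t)) (k * Real.exp (k * t)) t := by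
    simpa [mul_comm] using ((hasDerivAt_id t).const_mul k).exp
  refine ⟨fun t _ ↦ ((hasDerivAt_id t).mul (h t)).congr_deriv ?_,
    fun t _ ↦ ((((hasDerivAt_id t).const_mul k).const_add 1).mul (h t)).congr_deriv ?_⟩ <;>
  · simp
    ring

/-- Real part of the solution for the characteristic root `k + i m`; the sine below is the imaginary
part. -/
theorem solvesLinearODE_exp_mul_cos (k m : ℝ) :
    SolvesLinearODE (2 * k) (k ^ 2 + m ^ 2) 0 Set.univ
      (fun t ↦ Real.exp (k * t) * Real.cos (m * t))
      (fun t ↦ Real.exp (k * t) * (k * Real.cos (m * t) - m * Real.sin (m * t))) := by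
  have h (t : ℝ) : HasDerivAt (fun t ↦ Real.exp (k * t)) (k * Real.exp (k * t)) t := by
    simpa [mul_comm] using ((hasDerivAt_id t).const_mul k).exp
  have hc (t : ℝ) := ((hasDerivAt_id t).const_mul m).cos
  have hs (t : ℝ) := ((hasDerivAt_id t).const_mul m).sin
  refine ⟨fun t _ ↦ ((h t).mul (hc t)).congr_deriv ?_,
    fun t _ ↦ ((h t).mul (((hc t).const_mul k).sub ((hs t).const_mul m))).congr_deriv ?_⟩ <;>
  · simp
    ring

theorem solvesLinearODE_exp_mul_sin (k m : ℝ) :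
    SolvesLinearODE (2 * k) (k ^ 2 + m ^ 2) 0 Set.univ
      (fun t ↦ Real.exp (k * t) * Real.sin (m * t))
      (fun t ↦ Real.exp (k * t) * (k * Real.sin (m * t) + m * Real.cos (m * t))) := by
  have h (t : ℝ) : HasDerivAt (fun t ↦ Real.exp (k * t)) (k * Real.exp (k * t)) t := by
    simpa [mul_comm] using ((hasDerivAt_id t).const_mul k).exp
  have hc (t : ℝ) := ((hasDerivAt_id t).const_mul m).cos
  have hs (t : ℝ) := ((hasDerivAt_id t).const_mul m).sin
  refine ⟨fun t _ ↦ ((h t).mul (hs t)).congr_deriv ?_,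
    fun t _ ↦ ((h t).mul (((hs t).const_mul k).add ((hc t).const_mul m))).congr_deriv ?_⟩ <;>
  · simp
    ring

theorem solvesLinearODE_const {p q r : ℝ} (c : ℝ) (h : q * c = r) :
    SolvesLinearODE p q r Set.univ (fun _ ↦ c) (fun _ ↦ 0) :=
  ⟨fun t _ ↦ hasDerivAt_const t c, fun t _ ↦ (hasDerivAt_const t 0).congr_deriv (by linarith)⟩

theorem solvesLinearODE_linear {p r : ℝ} (c : ℝ) (h : p * c + r = 0) :
    SolvesLinearODE p 0 r Set.univ (fun t ↦ c * t) (fun _ ↦ c) :=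
  ⟨fun t _ ↦ by simpa using (hasDerivAt_id t).const_mul c,
    fun t _ ↦ (hasDerivAt_const t c).congr_deriv (by linarith)⟩

theorem solvesLinearODE_sq (c : ℝ) :
    SolvesLinearODE 0 0 (2 * c) Set.univ (fun t ↦ c * t ^ 2) (fun t ↦ 2 * c * t) :=
  ⟨fun t _ ↦ by simpa [mul_comm, mul_left_comm] using (hasDerivAt_pow 2 t).const_mul c,
    fun t _ ↦ by simpa using (hasDerivAt_id t).const_mul (2 * c)⟩

/-- Solutions of `v'' = (3/2) (lam₁ + lam₂) v' - (S - κ)/3 v + SF/3`, where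
`κ = 3 lam₁² + 3 lam₂² - 12 lam₁ lam₂`. -/
theorem warping_ode_iff {s : Set ℝ} {v v' v'' : ℝ → ℝ} (hs : IsOpen s) (hs' : IsPreconnected s)
    (hne : s.Nonempty) (hv : ∀ t ∈ s, HasDerivAt v (v' t) t)
    (hv' : ∀ t ∈ s, HasDerivAt v' (v'' t) t) (lam₁ lam₂ S SF : ℝ) :
    (∀ t ∈ s, v'' t = 3 / 2 * (lam₁ + lam₂) * v' t
        - (S - (3 * lam₁ ^ 2 + 3 * lam₂ ^ 2 - 12 * lam₁ * lam₂)) / 3 * v t + SF / 3) ↔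
      ((S < 27 / 16 * (lam₁ + lam₂) ^ 2 + 3 * lam₁ ^ 2 + 3 * lam₂ ^ 2 - 12 * lam₁ * lam₂ ∧
          S ≠ 3 * lam₁ ^ 2 + 3 * lam₂ ^ 2 - 12 * lam₁ * lam₂ ∧
          ∃ c₁ c₂ : ℝ, ∀ t ∈ s, v t =
            c₁ * Real.exp ((3 / 2 * (lam₁ + lam₂) + √(9 / 4 * (lam₁ + lam₂) ^ 2 - 4 / 3 * S
              + 4 * lam₁ ^ 2 + 4 * lam₂ ^ 2 - 16 * lam₁ * lam₂)) / 2 * t)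
            + c₂ * Real.exp ((3 / 2 * (lam₁ + lam₂) - √(9 / 4 * (lam₁ + lam₂) ^ 2 - 4 / 3 * S
              + 4 * lam₁ ^ 2 + 4 * lam₂ ^ 2 - 16 * lam₁ * lam₂)) / 2 * t)
            + SF / (12 * lam₁ * lam₂ - 3 * lam₁ ^ 2 - 3 * lam₂ ^ 2 + S)) ∨
       (S = 27 / 16 * (lam₁ + lam₂) ^ 2 + 3 * lam₁ ^ 2 + 3 * lam₂ ^ 2 - 12 * lam₁ * lam₂ ∧
          S ≠ 3 * lam₁ ^ 2 + 3 * lam₂ ^ 2 - 12 * lam₁ * lam₂ ∧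
          ∃ c₁ c₂ : ℝ, ∀ t ∈ s, v t =
            c₁ * Real.exp (3 / 4 * (lam₁ + lam₂) * t)
            + c₂ * t * Real.exp (3 / 4 * (lam₁ + lam₂) * t)
            + SF / (12 * lam₁ * lam₂ - 3 * lam₁ ^ 2 - 3 * lam₂ ^ 2 + S)) ∨
       (27 / 16 * (lam₁ + lam₂) ^ 2 + 3 * lam₁ ^ 2 + 3 * lam₂ ^ 2 - 12 * lam₁ * lam₂ < S ∧
          ∃ c₁ c₂ : ℝ, ∀ t ∈ s, v t =
            c₁ * Real.exp (3 / 4 * (lam₁ + lam₂) * t)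
              * Real.cos (√(4 / 3 * S - 4 * lam₁ ^ 2 - 4 * lam₂ ^ 2 + 16 * lam₁ * lam₂
                - 9 / 4 * (lam₁ + lam₂) ^ 2) / 2 * t)
            + c₂ * Real.exp (3 / 4 * (lam₁ + lam₂) * t)
              * Real.sin (√(4 / 3 * S - 4 * lam₁ ^ 2 - 4 * lam₂ ^ 2 + 16 * lam₁ * lam₂
                - 9 / 4 * (lam₁ + lam₂) ^ 2) / 2 * t)
            + SF / (12 * lam₁ * lam₂ - 3 * lam₁ ^ 2 - 3 * lam₂ ^ 2 + S)) ∨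
       (S = 3 * lam₁ ^ 2 + 3 * lam₂ ^ 2 - 12 * lam₁ * lam₂ ∧ lam₁ + lam₂ ≠ 0 ∧
          ∃ c₁ c₂ : ℝ, ∀ t ∈ s, v t =
            c₁ - 2 * SF / (9 * (lam₁ + lam₂)) * t + c₂ * Real.exp (3 / 2 * (lam₁ + lam₂) * t)) ∨
       (S = 3 * lam₁ ^ 2 + 3 * lam₂ ^ 2 - 12 * lam₁ * lam₂ ∧ lam₁ + lam₂ = 0 ∧
          ∃ c₁ c₂ : ℝ, ∀ t ∈ s, v t = SF / 6 * t ^ 2 + c₁ * t + c₂)) := by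
  set L := lam₁ + lam₂ with hL
  -- All coefficients depend on `lam₁`, `lam₂` only through `L` and `κ`, which are free parameters
  -- from here on.
  obtain ⟨κ, hκ⟩ : ∃ κ, κ = 3 * lam₁ ^ 2 + 3 * lam₂ ^ 2 - 12 * lam₁ * lam₂ := ⟨_, rfl⟩
  have e₁ : 27 / 16 * L ^ 2 + 3 * lam₁ ^ 2 + 3 * lam₂ ^ 2 - 12 * lam₁ * lam₂
      = 27 / 16 * L ^ 2 + κ := by rw [hκ]; ring
  have e₂ : 9 / 4 * L ^ 2 - 4 / 3 * S + 4 * lam₁ ^ 2 + 4 * lam₂ ^ 2 - 16 * lam₁ * lam₂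
      = 9 / 4 * L ^ 2 - 4 / 3 * (S - κ) := by rw [hκ]; ring
  have e₃ : 12 * lam₁ * lam₂ - 3 * lam₁ ^ 2 - 3 * lam₂ ^ 2 + S = S - κ := by rw [hκ]; ring
  have e₄ : 4 / 3 * S - 4 * lam₁ ^ 2 - 4 * lam₂ ^ 2 + 16 * lam₁ * lam₂ - 9 / 4 * L ^ 2
      = 4 / 3 * (S - κ) - 9 / 4 * L ^ 2 := by rw [hκ]; ring
  rw [e₁, e₂, e₃, e₄, ← hκ]
  clear e₁ e₂ e₃ e₄ hκ
  clear_value L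
  have hpart (h : S ≠ κ) : (S - κ) / 3 * (SF / (S - κ)) = SF / 3 := by
    have := sub_ne_zero.2 h
    field_simp
  rcases eq_or_ne S κ with rfl | hSκ
  · rcases eq_or_ne L 0 with rfl | hL0
    · rw [forall_deriv_eq_iff_exists_eq (p := 3 / 2 * 0) (q := (S - S) / 3) hs hs' hne hv hv'
        (y := fun t ↦ 1 * t) (z := fun _ ↦ 1)
        (by simpa using solvesLinearODE_linear (p := 0) (r := 0) 1 (by simp))
        (solvesLinearODE_const 1 (by simp))
        (by simpa [show 2 * (SF / 6) = SF / 3 by ring] using solvesLinearODE_sq (SF / 6))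
        (by simp)]
      -- As `27/16 L² ≥ 0`, the oscillating case cannot meet `S = κ`; hence it carries no condition
      -- `S ≠ κ`.
      have h9 : ¬ (27 / 16 * (0 : ℝ) ^ 2 + S < S) := by simp
      simp only [ne_eq, not_true_eq_false, false_and, and_false, h9, true_and, false_or]
      refine exists_congr fun c₁ ↦ exists_congr fun c₂ ↦ forall₂_congr fun t _ ↦ ?_
      rw [show c₁ * (1 * t) + c₂ * 1 + SF / 6 * t ^ 2 = SF / 6 * t ^ 2 + c₁ * t + c₂ by ring]
    · have h9 : 0 < 27 / 16 * L ^ 2 := by positivity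
      rw [forall_deriv_eq_iff_exists_eq (p := 3 / 2 * L) (q := (S - S) / 3) hs hs' hne hv hv'
        (y := fun _ ↦ 1) (z := fun t ↦ Real.exp (3 / 2 * L * t))
        (w := fun t ↦ -(2 * SF / (9 * L)) * t)
        (solvesLinearODE_const 1 (by simp))
        (solvesLinearODE_exp (by ring))
        (by simpa using solvesLinearODE_linear (p := 3 / 2 * L) (r := SF / 3)
              (-(2 * SF / (9 * L))) (by field_simp; ring))
        (by intro t; simp [hL0])]
      have : ¬ (27 / 16 * L ^ 2 + S < S) := by linarith
      simp only [ne_eq, not_true_eq_false, false_and, and_false, this, hL0, not_false_eq_true,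
        true_and, false_or, or_false]
      refine exists_congr fun c₁ ↦ exists_congr fun c₂ ↦ forall₂_congr fun t _ ↦ ?_
      rw [show c₁ * 1 + c₂ * Real.exp (3 / 2 * L * t) + -(2 * SF / (9 * L)) * t
        = c₁ - 2 * SF / (9 * L) * t + c₂ * Real.exp (3 / 2 * L * t) by ring]
  · rcases lt_trichotomy S (27 / 16 * L ^ 2 + κ) with h | h | h
    · have hpos : 0 < 9 / 4 * L ^ 2 - 4 / 3 * (S - κ) := by linarith
      have hsq := Real.sq_sqrt hpos.le
      have hsq' := (Real.sqrt_pos.2 hpos).ne'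
      set d := √(9 / 4 * L ^ 2 - 4 / 3 * (S - κ))
      rw [forall_deriv_eq_iff_exists_eq (p := 3 / 2 * L) (q := (S - κ) / 3) hs hs' hne hv hv'
        (solvesLinearODE_exp (k := (3 / 2 * L + d) / 2) (by linear_combination hsq / 4))
        (solvesLinearODE_exp (k := (3 / 2 * L - d) / 2) (by linear_combination hsq / 4))
        (solvesLinearODE_const _ (hpart hSκ))
        (by
          intro t
          rw [show Real.exp ((3 / 2 * L + d) / 2 * t) * ((3 / 2 * L - d) / 2 *
            Real.exp ((3 / 2 * L - d) / 2 * t)) - (3 / 2 * L + d) / 2 *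
            Real.exp ((3 / 2 * L + d) / 2 * t) * Real.exp ((3 / 2 * L - d) / 2 * t)
            = -d * (Real.exp ((3 / 2 * L + d) / 2 * t) * Real.exp ((3 / 2 * L - d) / 2 * t)) by
              ring]
          simp [hsq', Real.exp_ne_zero])]
      simp only [h, hSκ, h.ne, not_lt_of_gt h, false_and, or_false, ne_eq, not_false_eq_true,
        true_and]
    · rw [forall_deriv_eq_iff_exists_eq (p := 3 / 2 * L) (q := (S - κ) / 3) hs hs' hne hv hv'
        (y := fun t ↦ Real.exp (3 / 4 * L * t)) (z := fun t ↦ t * Real.exp (3 / 4 * L * t))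
        (solvesLinearODE_exp (k := 3 / 4 * L) (by rw [h]; ring))
        (by
          have := solvesLinearODE_mul_exp (3 / 4 * L)
          rwa [show 2 * (3 / 4 * L) = 3 / 2 * L by ring,
            show (3 / 4 * L) ^ 2 = (S - κ) / 3 by rw [h]; ring] at this)
        (solvesLinearODE_const _ (hpart hSκ))
        (by
          intro t
          rw [show Real.exp (3 / 4 * L * t) * ((1 + 3 / 4 * L * t) * Real.exp (3 / 4 * L * t)) -
            3 / 4 * L * Real.exp (3 / 4 * L * t) * (t * Real.exp (3 / 4 * L * t))
            = Real.exp (3 / 4 * L * t) * Real.exp (3 / 4 * L * t) by ring]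
          simp [Real.exp_ne_zero])]
      simp only [h.not_gt, h.not_lt, hSκ, false_and, or_false, ne_eq, not_false_eq_true,
        true_and, false_or, mul_assoc, and_iff_right h]
    · have hpos : 0 < 4 / 3 * (S - κ) - 9 / 4 * L ^ 2 := by linarith
      have hsq := Real.sq_sqrt hpos.le
      have hsq' := (Real.sqrt_pos.2 hpos).ne'
      set d := √(4 / 3 * (S - κ) - 9 / 4 * L ^ 2)
      have hq : (3 / 4 * L) ^ 2 + (d / 2) ^ 2 = (S - κ) / 3 := by linear_combination hsq / 4
      have hcos := solvesLinearODE_exp_mul_cos (3 / 4 * L) (d / 2)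
      have hsin := solvesLinearODE_exp_mul_sin (3 / 4 * L) (d / 2)
      rw [hq, show 2 * (3 / 4 * L) = 3 / 2 * L by ring] at hcos hsin
      rw [forall_deriv_eq_iff_exists_eq (p := 3 / 2 * L) (q := (S - κ) / 3) hs hs' hne hv hv'
        hcos hsin (solvesLinearODE_const _ (hpart hSκ))
        (by
          intro t
          have hcs := Real.sin_sq_add_cos_sq (d / 2 * t)
          rw [show ∀ e c s : ℝ, e * c * (e * (3 / 4 * L * s + d / 2 * c)) -
            e * (3 / 4 * L * c - d / 2 * s) * (e * s) = d / 2 * (e * e) * (s ^ 2 + c ^ 2) by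
              intros; ring, hcs]
          simp [hsq', Real.exp_ne_zero])]
      simp only [h, hSκ, h.ne', not_lt_of_gt h, false_and, or_false, ne_eq, not_false_eq_true,
        true_and, false_or, mul_assoc]

end SecondOrderODE

/-! ### Metrics and connections on open subsets of a vector space. -/

section LocalGeometryLemmas

variable {E : Type*} [NormedAddCommGroup E] [NormedSpace ℝ E]

/-- A basis of `E` identifies `E →L[ℝ] F` with a finite power of `F`. -/
theorem contDiffAt_of_forall_clm_apply [FiniteDimensional ℝ E] {D F : Type*}
    [NormedAddCommGroup D] [NormedSpace ℝ D] [NormedAddCommGroup F] [NormedSpace ℝ F]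
    {n : WithTop ℕ∞} {A : D → E →L[ℝ] F} {x : D}
    (h : ∀ v, ContDiffAt ℝ n (fun y ↦ A y v) x) : ContDiffAt ℝ n A x := by
  let d := Module.finrank ℝ E
  let e₁ := ContinuousLinearEquiv.ofFinrankEq (Module.finrank_fin_fun ℝ (n := d)).symm
  let e₂ := (e₁.arrowCongr (1 : F ≃L[ℝ] F)).trans (ContinuousLinearEquiv.piRing (Fin d))
  rw [← Function.id_comp A, ← e₂.symm_comp_self]
  exact e₂.symm.contDiff.contDiffAt.comp x (contDiffAt_pi.2 fun i ↦ h _)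

theorem contDiffAt_of_forall_clm_apply₂ [FiniteDimensional ℝ E] {D F : Type*}
    [NormedAddCommGroup D] [NormedSpace ℝ D] [NormedAddCommGroup F] [NormedSpace ℝ F]
    {n : WithTop ℕ∞} {A : D → E →L[ℝ] E →L[ℝ] F} {x : D}
    (h : ∀ v w, ContDiffAt ℝ n (fun y ↦ A y v w) x) : ContDiffAt ℝ n A x :=
  contDiffAt_of_forall_clm_apply fun v ↦ contDiffAt_of_forall_clm_apply (h v)

theorem fderiv_clm_apply₂ {D F : Type*}
    [NormedAddCommGroup D] [NormedSpace ℝ D] [NormedAddCommGroup F] [NormedSpace ℝ F]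
    {A : D → E →L[ℝ] E →L[ℝ] F} {x : D} (h : DifferentiableAt ℝ A x) (u : D) (v w : E) :
    fderiv ℝ A x u v w = fderiv ℝ (fun y ↦ A y v w) x u := by
  have := ((h.hasFDerivAt.clm_apply (hasFDerivAt_const v x)).clm_apply (hasFDerivAt_const w x))
  rw [this.fderiv]
  simp

/-- Guarantees that `ContinuousLinearMap.inverse` is a true inverse of the metric and not its
default value `0`. -/
theorem exists_equiv_eq_of_nondegenerate [FiniteDimensional ℝ E] {B : E →L[ℝ] E →L[ℝ] ℝ}
    (hB : ∀ v, (∀ w, B v w = 0) → v = 0) :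
    ∃ e : E ≃L[ℝ] (E →L[ℝ] ℝ), (e : E →L[ℝ] E →L[ℝ] ℝ) = B := by
  have hinj : Function.Injective (B : E →ₗ[ℝ] E →L[ℝ] ℝ) := by
    rw [injective_iff_map_eq_zero]
    exact fun v hv ↦ hB v fun w ↦ by
      have := congrArg (fun φ : E →L[ℝ] ℝ ↦ φ w) hv
      simpa using this
  have hrank : Module.finrank ℝ E = Module.finrank ℝ (E →L[ℝ] ℝ) := by
    rw [← (LinearMap.toContinuousLinearMap : (E →ₗ[ℝ] ℝ) ≃ₗ[ℝ] (E →L[ℝ] ℝ)).finrank_eq]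
    exact (Subspace.dual_finrank_eq (K := ℝ) (V := E)).symm
  refine ⟨(LinearEquiv.ofInjectiveOfFinrankEq (B : E →ₗ[ℝ] E →L[ℝ] ℝ) hinj
    hrank).toContinuousLinearEquiv, ?_⟩
  ext v w
  rfl

theorem inverse_eq_iff_of_nondegenerate [FiniteDimensional ℝ E] {B : E →L[ℝ] E →L[ℝ] ℝ}
    (hB : ∀ v, (∀ w, B v w = 0) → v = 0) (φ : E →L[ℝ] ℝ) (u : E) :
    B.inverse φ = u ↔ ∀ w, B u w = φ w := by
  obtain ⟨e, rfl⟩ := exists_equiv_eq_of_nondegenerate hB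
  rw [ContinuousLinearMap.inverse_equiv]
  simp only [ContinuousLinearEquiv.coe_coe]
  rw [e.symm_apply_eq, ContinuousLinearMap.ext_iff]
  exact forall_congr' fun w ↦ eq_comm

/-- A smooth pseudo-Riemannian metric on an open subset of a vector space. -/
structure IsLocalMetric (U : Set E) (G : E → E →L[ℝ] E →L[ℝ] ℝ) : Prop where
  isOpen : IsOpen U
  symm : ∀ y ∈ U, ∀ v w, G y v w = G y w v
  nondegenerate : ∀ y ∈ U, ∀ v, (∀ w, G y v w = 0) → v = 0
  contDiffOn : ContDiffOn ℝ ∞ G U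

theorem christoffelFirstKind_apply (G : E → E →L[ℝ] E →L[ℝ] ℝ) (y u v w : E) :
    christoffelFirstKind G y u v w =
      1 / 2 * (fderiv ℝ G y u v w + fderiv ℝ G y v u w - fderiv ℝ G y w u v) := by
  simp [christoffelFirstKind]

theorem quarterSymmetricChristoffel_apply (lam₁ lam₂ : ℝ) (G : E → E →L[ℝ] E →L[ℝ] ℝ) (P : E → E)
    (y u v : E) :
    quarterSymmetricChristoffel lam₁ lam₂ G P y u v =
      leviCivitaChristoffel G y u v + lam₁ • G y v (P y) • u - lam₂ • G y u v • P y := by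
  simp [quarterSymmetricChristoffel]

namespace IsLocalMetric

variable {U : Set E} {G : E → E →L[ℝ] E →L[ℝ] ℝ} {y : E}

theorem contDiffAt (hG : IsLocalMetric U G) (hy : y ∈ U) : ContDiffAt ℝ ∞ G y :=
  hG.contDiffOn.contDiffAt (hG.isOpen.mem_nhds hy)

theorem differentiableAt (hG : IsLocalMetric U G) (hy : y ∈ U) : DifferentiableAt ℝ G y :=
  (hG.contDiffAt hy).differentiableAt (by simp)

theorem fderiv_symm (hG : IsLocalMetric U G) (hy : y ∈ U) (u v w : E) :
    fderiv ℝ G y u v w = fderiv ℝ G y u w v := by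
  rw [fderiv_clm_apply₂ (hG.differentiableAt hy), fderiv_clm_apply₂ (hG.differentiableAt hy)]
  have : (fun z ↦ G z v w) =ᶠ[nhds y] fun z ↦ G z w v :=
    Filter.eventually_of_mem (hG.isOpen.mem_nhds hy) fun z hz ↦ hG.symm z hz v w
  rw [this.fderiv_eq]

variable [FiniteDimensional ℝ E]

/-- The Koszul formula; it reduces finding the Christoffel map to checking a candidate against all
`w`. -/
theorem leviCivitaChristoffel_eq_iff (hG : IsLocalMetric U G) (hy : y ∈ U) (u v X : E) :
    leviCivitaChristoffel G y u v = X ↔ ∀ w, G y X w =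
      1 / 2 * (fderiv ℝ G y u v w + fderiv ℝ G y v u w - fderiv ℝ G y w u v) := by
  have : leviCivitaChristoffel G y u v = (G y).inverse (christoffelFirstKind G y u v) := by
    simp [leviCivitaChristoffel]
  rw [this, inverse_eq_iff_of_nondegenerate (hG.nondegenerate y hy)]
  simp only [christoffelFirstKind_apply]

theorem apply_leviCivitaChristoffel (hG : IsLocalMetric U G) (hy : y ∈ U) (u v w : E) :
    G y (leviCivitaChristoffel G y u v) w =
      1 / 2 * (fderiv ℝ G y u v w + fderiv ℝ G y v u w - fderiv ℝ G y w u v) :=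
  (hG.leviCivitaChristoffel_eq_iff hy u v _).1 rfl w

theorem leviCivitaChristoffel_symm (hG : IsLocalMetric U G) (hy : y ∈ U) (u v : E) :
    leviCivitaChristoffel G y u v = leviCivitaChristoffel G y v u := by
  rw [hG.leviCivitaChristoffel_eq_iff hy]
  intro w
  rw [hG.apply_leviCivitaChristoffel hy, hG.fderiv_symm hy w v u]
  ring

/-- Metric compatibility, `∇G = 0`. -/
theorem fderiv_eq (hG : IsLocalMetric U G) (hy : y ∈ U) (u v w : E) :
    fderiv ℝ G y u v w =
      G y (leviCivitaChristoffel G y u v) w + G y v (leviCivitaChristoffel G y u w) := by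
  rw [hG.symm y hy v, hG.apply_leviCivitaChristoffel hy, hG.apply_leviCivitaChristoffel hy,
    hG.fderiv_symm hy u w v]
  ring

theorem contDiffAt_leviCivitaChristoffel (hG : IsLocalMetric U G) (hy : y ∈ U) :
    ContDiffAt ℝ ∞ (leviCivitaChristoffel G) y := by
  refine contDiffAt_of_forall_clm_apply₂ fun u v ↦ ?_
  have h (z : E) : leviCivitaChristoffel G z u v
      = (G z).inverse (christoffelFirstKind G z u v) := by
    simp [leviCivitaChristoffel]
  simp only [h]
  have hfd : ContDiffAt ℝ ∞ (fderiv ℝ G) y := (hG.contDiffAt hy).fderiv_right (by simp)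
  have h₁ : ContDiffAt ℝ ∞ (fun z ↦ christoffelFirstKind G z u v) y := by
    refine contDiffAt_of_forall_clm_apply fun w ↦ ?_
    simp only [christoffelFirstKind_apply]
    have hap (a b c : E) : ContDiffAt ℝ ∞ (fun z ↦ fderiv ℝ G z a b c) y :=
      ((hfd.clm_apply contDiffAt_const).clm_apply contDiffAt_const).clm_apply contDiffAt_const
    exact contDiffAt_const.mul (((hap u v w).add (hap v u w)).sub (hap w u v))
  have h₂ : ContDiffAt ℝ ∞ (fun z ↦ (G z).inverse) y := by
    obtain ⟨e, he⟩ := exists_equiv_eq_of_nondegenerate (hG.nondegenerate y hy)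
    have h := contDiffAt_map_inverse (n := ∞) e
    rw [he] at h
    exact h.comp y (hG.contDiffAt hy)
  exact h₂.clm_apply h₁

end IsLocalMetric

/-- The curvature `w ↦ R(u, w) v`. -/
def localCurvatureOperator (Γ : E → E →L[ℝ] E →L[ℝ] E) (y u v : E) : E →ₗ[ℝ] E where
  toFun w := localCurvature Γ y u w v
  map_add' w w' := by simp [localCurvature]; abel
  map_smul' c w := by simp [localCurvature, smul_sub, smul_add]

@[simp]
theorem localCurvatureOperator_apply (Γ : E → E →L[ℝ] E →L[ℝ] E) (y u v w : E) :
    localCurvatureOperator Γ y u v w = localCurvature Γ y u w v := rfl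

theorem localRicci_apply (Γ : E → E →L[ℝ] E →L[ℝ] E) (y u v : E) :
    localRicci Γ y u v = LinearMap.trace ℝ E (localCurvatureOperator Γ y u v) := rfl

/-- Only the germ of the connection matters, so formulas valid merely near the base point of a chart
suffice. -/
theorem localScalarCurvature_congr [FiniteDimensional ℝ E] {G G' : E → E →L[ℝ] E →L[ℝ] ℝ}
    {Γ Γ' : E → E →L[ℝ] E →L[ℝ] E} {y : E} (hG : G y = G' y) (hΓ : Γ =ᶠ[nhds y] Γ') :
    localScalarCurvature G Γ y = localScalarCurvature G' Γ' y := by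
  have : localRicci Γ y = localRicci Γ' y := by
    ext u v
    rw [localRicci_apply, localRicci_apply]
    congr 1
    ext w
    simp [localCurvature, hΓ.fderiv_eq, hΓ.self_of_nhds]
  rw [localScalarCurvature, localScalarCurvature, this, hG]

theorem leviCivitaChristoffel_congr {G G' : E → E →L[ℝ] E →L[ℝ] ℝ} {y : E}
    (hG : G =ᶠ[nhds y] G') :
    leviCivitaChristoffel G =ᶠ[nhds y] leviCivitaChristoffel G' := by
  filter_upwards [hG.eventuallyEq_nhds] with z hz
  simp [leviCivitaChristoffel, christoffelFirstKind, hz.fderiv_eq, hz.self_of_nhds]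

theorem quarterSymmetricChristoffel_congr (lam₁ lam₂ : ℝ) {G G' : E → E →L[ℝ] E →L[ℝ] ℝ}
    {P P' : E → E} {y : E} (hG : G =ᶠ[nhds y] G') (hP : P =ᶠ[nhds y] P') :
    quarterSymmetricChristoffel lam₁ lam₂ G P =ᶠ[nhds y]
      quarterSymmetricChristoffel lam₁ lam₂ G' P' := by
  filter_upwards [hG, hP, leviCivitaChristoffel_congr hG] with z h₁ h₂ h₃
  simp [quarterSymmetricChristoffel, h₁, h₂, h₃]

/-- The Ricci operator, `G y (Q u) v = Ric(u, v)`. -/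
def localRicciOperator [FiniteDimensional ℝ E] (G : E → E →L[ℝ] E →L[ℝ] ℝ)
    (Γ : E → E →L[ℝ] E →L[ℝ] E) (y : E) : E →ₗ[ℝ] E :=
  ((G y).inverse : (E →L[ℝ] ℝ) →ₗ[ℝ] E) ∘ₗ
    (LinearMap.toContinuousLinearMap : (E →ₗ[ℝ] ℝ) ≃ₗ[ℝ] (E →L[ℝ] ℝ)).toLinearMap ∘ₗ
    localRicci Γ y

theorem localScalarCurvature_eq_trace [FiniteDimensional ℝ E] (G : E → E →L[ℝ] E →L[ℝ] ℝ)
    (Γ : E → E →L[ℝ] E →L[ℝ] E) (y : E) :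
    localScalarCurvature G Γ y = LinearMap.trace ℝ E (localRicciOperator G Γ y) := rfl

theorem localRicciOperator_eq_iff [FiniteDimensional ℝ E] {G : E → E →L[ℝ] E →L[ℝ] ℝ}
    {y : E} (hG : ∀ v, (∀ w, G y v w = 0) → v = 0)
    (Γ : E → E →L[ℝ] E →L[ℝ] E) (u X : E) :
    localRicciOperator G Γ y u = X ↔ ∀ v, G y X v = localRicci Γ y u v :=
  inverse_eq_iff_of_nondegenerate hG _ _

/-- Sum of the traces of the two diagonal blocks, by cyclicity of the trace. -/
theorem LinearMap.trace_prod_eq_add [FiniteDimensional ℝ E] (T : ℝ × E →ₗ[ℝ] ℝ × E) :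
    LinearMap.trace ℝ (ℝ × E) T = (T (1, 0)).1 +
      LinearMap.trace ℝ E (LinearMap.snd ℝ ℝ E ∘ₗ T ∘ₗ LinearMap.inr ℝ ℝ E) := by
  have h : T = LinearMap.inl ℝ ℝ E ∘ₗ (LinearMap.fst ℝ ℝ E ∘ₗ T)
      + LinearMap.inr ℝ ℝ E ∘ₗ (LinearMap.snd ℝ ℝ E ∘ₗ T) := by
    ext <;> simp
  conv_lhs => rw [h]
  rw [map_add, LinearMap.trace_comp_comm' _ (LinearMap.inl ℝ ℝ E),
    LinearMap.trace_comp_comm' _ (LinearMap.inr ℝ ℝ E), LinearMap.comp_assoc, LinearMap.comp_assoc]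
  congr 1
  have : LinearMap.fst ℝ ℝ E ∘ₗ T ∘ₗ LinearMap.inl ℝ ℝ E
      = (T (1, 0)).1 • LinearMap.id := by
    ext
    simp
  rw [this]
  simp

end LocalGeometryLemmas

/-! ### The warped product in coordinates. -/

section WarpedProductLocal

variable {E : Type*} [NormedAddCommGroup E] [NormedSpace ℝ E]

/-- The metric `-dt² + f(t)² H` on an open subset of `ℝ × E`. -/
def localWarpedMetric (f : ℝ → ℝ) (H : E → E →L[ℝ] E →L[ℝ] ℝ) (z : ℝ × E) :
    ℝ × E →L[ℝ] ℝ × E →L[ℝ] ℝ :=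
  -(ContinuousLinearMap.mul ℝ ℝ).bilinearComp (ContinuousLinearMap.fst ℝ ℝ E)
      (ContinuousLinearMap.fst ℝ ℝ E) +
    (f z.1) ^ 2 • (H z.2).bilinearComp (ContinuousLinearMap.snd ℝ ℝ E)
      (ContinuousLinearMap.snd ℝ ℝ E)

theorem localWarpedMetric_apply (f : ℝ → ℝ) (H : E → E →L[ℝ] E →L[ℝ] ℝ) (z u v : ℝ × E) :
    localWarpedMetric f H z u v = -(u.1 * v.1) + (f z.1) ^ 2 * H z.2 u.2 v.2 := by
  simp [localWarpedMetric]

variable [FiniteDimensional ℝ E] {V : Set ℝ} {U : Set E} {f : ℝ → ℝ}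
  {H : E → E →L[ℝ] E →L[ℝ] ℝ}

omit [FiniteDimensional ℝ E] in
theorem contDiffAt_clm_apply₂_comp_snd {F : Type*} [NormedAddCommGroup F] [NormedSpace ℝ F]
    {K : E → E →L[ℝ] E →L[ℝ] F} {z : ℝ × E} (h : ContDiffAt ℝ ∞ K z.2) (v w : E) :
    ContDiffAt ℝ ∞ (fun z : ℝ × E ↦ K z.2 v w) z :=
  ((h.comp z contDiffAt_snd).clm_apply contDiffAt_const).clm_apply contDiffAt_const

omit [FiniteDimensional ℝ E] in
theorem hasFDerivAt_clm_apply₂_comp_snd {F : Type*} [NormedAddCommGroup F] [NormedSpace ℝ F]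
    {K : E → E →L[ℝ] E →L[ℝ] F} {z : ℝ × E} (h : DifferentiableAt ℝ K z.2) (v w : E) :
    HasFDerivAt (fun z : ℝ × E ↦ K z.2 v w)
      (((fderiv ℝ K z.2).flip v).flip w ∘L ContinuousLinearMap.snd ℝ ℝ E) z := by
  have := (((h.hasFDerivAt.comp z hasFDerivAt_snd).clm_apply (hasFDerivAt_const v z)).clm_apply
    (hasFDerivAt_const w z))
  refine this.congr_fderiv ?_
  ext <;> simp

theorem isLocalMetric_localWarpedMetric (hV : IsOpen V) (hf : ContDiffOn ℝ ∞ f V)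
    (hpos : ∀ t ∈ V, 0 < f t) (hH : IsLocalMetric U H) :
    IsLocalMetric (V ×ˢ U) (localWarpedMetric f H) where
  isOpen := hV.prod hH.isOpen
  symm z hz v w := by
    rw [localWarpedMetric_apply, localWarpedMetric_apply, hH.symm z.2 hz.2, mul_comm v.1]
  nondegenerate z hz v hv := by
    have h₁ : v.1 = 0 := by simpa [localWarpedMetric_apply] using hv (1, 0)
    have h₂ : v.2 = 0 := hH.nondegenerate z.2 hz.2 _ fun w ↦ by
      simpa [localWarpedMetric_apply, (hpos z.1 hz.1).ne'] using hv (0, w)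
    exact Prod.ext h₁ h₂
  contDiffOn z hz := by
    refine ContDiffAt.contDiffWithinAt (contDiffAt_of_forall_clm_apply₂ fun v w ↦ ?_)
    simp only [localWarpedMetric_apply]
    exact contDiffAt_const.add ((((hf.contDiffAt (hV.mem_nhds hz.1)).comp z
      contDiffAt_fst).pow 2).mul (contDiffAt_clm_apply₂_comp_snd (hH.contDiffAt hz.2) _ _))

theorem fderiv_localWarpedMetric (hV : IsOpen V) (hf : ContDiffOn ℝ ∞ f V)
    (hpos : ∀ t ∈ V, 0 < f t) (hH : IsLocalMetric U H) {z : ℝ × E} (hz : z ∈ V ×ˢ U)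
    (u v w : ℝ × E) :
    fderiv ℝ (localWarpedMetric f H) z u v w =
      2 * f z.1 * deriv f z.1 * u.1 * H z.2 v.2 w.2
        + (f z.1) ^ 2 * fderiv ℝ H z.2 u.2 v.2 w.2 := by
  rw [fderiv_clm_apply₂
    ((isLocalMetric_localWarpedMetric hV hf hpos hH).differentiableAt hz)]
  simp only [localWarpedMetric_apply]
  have hfd : HasDerivAt f (deriv f z.1) z.1 :=
    ((hf.contDiffAt (hV.mem_nhds hz.1)).differentiableAt (by simp)).hasDerivAt
  have h := (((hfd.pow 2).hasFDerivAt.comp z hasFDerivAt_fst).mul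
    (hasFDerivAt_clm_apply₂_comp_snd (hH.differentiableAt hz.2) v.2 w.2)).const_add
    (-(v.1 * w.1))
  refine (congrArg (· u) h.fderiv).trans ?_
  simp
  ring

theorem leviCivitaChristoffel_localWarpedMetric (hV : IsOpen V) (hf : ContDiffOn ℝ ∞ f V)
    (hpos : ∀ t ∈ V, 0 < f t) (hH : IsLocalMetric U H) {z : ℝ × E} (hz : z ∈ V ×ˢ U)
    (u v : ℝ × E) :
    leviCivitaChristoffel (localWarpedMetric f H) z u v =
      (f z.1 * deriv f z.1 * H z.2 u.2 v.2,
        leviCivitaChristoffel H z.2 u.2 v.2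
          + (deriv f z.1 / f z.1) • (u.1 • v.2 + v.1 • u.2)) := by
  rw [(isLocalMetric_localWarpedMetric hV hf hpos hH).leviCivitaChristoffel_eq_iff hz]
  intro w
  have hf0 := (hpos z.1 hz.1).ne'
  simp only [fderiv_localWarpedMetric hV hf hpos hH hz, localWarpedMetric_apply, map_add, map_smul,
    add_apply, smul_apply, smul_eq_mul,
    hH.apply_leviCivitaChristoffel hz.2]
  field_simp
  ring

/-- The shape of the Christoffel map of the quarter-symmetric connection of a warped product. -/
def warpedChristoffel (A : ℝ) (b c d : ℝ → ℝ) (H : E → E →L[ℝ] E →L[ℝ] ℝ) (z u v : ℝ × E) :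
    ℝ × E :=
  (A * u.1 * v.1 + b z.1 * H z.2 u.2 v.2,
    leviCivitaChristoffel H z.2 u.2 v.2 + (d z.1 * u.1) • v.2 + (c z.1 * v.1) • u.2)

/-- Here `π(v) = -v.1`, so `lam₁ π(v) u` lowers both the `u.1 v.1` coefficient and `c` by `lam₁`.
The term in `lam₂` affects only the time component. The inequality of `c` and `d` reflects torsion.
-/
theorem quarterSymmetricChristoffel_localWarpedMetric (hV : IsOpen V) (hf : ContDiffOn ℝ ∞ f V)
    (hpos : ∀ t ∈ V, 0 < f t) (hH : IsLocalMetric U H) {z : ℝ × E} (hz : z ∈ V ×ˢ U)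
    (lam₁ lam₂ : ℝ) (u v : ℝ × E) :
    quarterSymmetricChristoffel lam₁ lam₂ (localWarpedMetric f H) (fun _ ↦ (1, 0)) z u v =
      warpedChristoffel (lam₂ - lam₁) (fun t ↦ f t * deriv f t - lam₂ * f t ^ 2)
        (fun t ↦ deriv f t / f t - lam₁) (fun t ↦ deriv f t / f t) H z u v := by
  rw [quarterSymmetricChristoffel_apply,
    leviCivitaChristoffel_localWarpedMetric hV hf hpos hH hz, localWarpedMetric_apply,
    localWarpedMetric_apply]
  ext
  · simp [warpedChristoffel]
    ring
  · simp [warpedChristoffel]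
    module

/-! ### Curvature of a connection of warped shape. -/

section Curvature

variable {A : ℝ} {b c d : ℝ → ℝ} {Γ : ℝ × E → ℝ × E →L[ℝ] ℝ × E →L[ℝ] ℝ × E}
  {z : ℝ × E}

theorem hasFDerivAt_warpedChristoffel (hH : IsLocalMetric U H) (hz : z.2 ∈ U)
    {b' c' d' : ℝ} (hb : HasDerivAt b b' z.1) (hc : HasDerivAt c c' z.1)
    (hd : HasDerivAt d d' z.1) (v w : ℝ × E) :
    ∃ T : ℝ × E →L[ℝ] ℝ × E, HasFDerivAt (fun z ↦ warpedChristoffel A b c d H z v w) T z ∧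
      ∀ u : ℝ × E, T u =
        (b' * u.1 * H z.2 v.2 w.2 + b z.1 * fderiv ℝ H z.2 u.2 v.2 w.2,
        fderiv ℝ (leviCivitaChristoffel H) z.2 u.2 v.2 w.2 + (d' * u.1 * v.1) • w.2
          + (c' * u.1 * w.1) • v.2) := by
  have hK := (hH.contDiffAt_leviCivitaChristoffel hz).differentiableAt (by simp)
  have h₁ := ((hb.hasFDerivAt.comp z hasFDerivAt_fst).mul
    (hasFDerivAt_clm_apply₂_comp_snd (hH.differentiableAt hz) v.2 w.2)).const_add
    (A * v.1 * w.1)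
  have h₂ := ((hasFDerivAt_clm_apply₂_comp_snd hK v.2 w.2).add
    (((hd.hasFDerivAt.comp z hasFDerivAt_fst).mul_const v.1).smul_const w.2)).add
    (((hc.hasFDerivAt.comp z hasFDerivAt_fst).mul_const w.1).smul_const v.2)
  refine ⟨_, h₁.prodMk h₂, fun u ↦ ?_⟩
  ext
  · simp
    ring
  · simp
    module

/-- Antisymmetrising in `u`, `w` removes `d'`, whose term is symmetric. The derivatives of `H`
cancel by metric compatibility and symmetry of the Levi-Civita connection of `H`. -/
theorem localCurvature_of_eventuallyEq_warpedChristoffel (hH : IsLocalMetric U H) (hz : z.2 ∈ U)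
    (hΓ : ∀ᶠ y in nhds z, ∀ u v, Γ y u v = warpedChristoffel A b c d H y u v)
    (hΓd : DifferentiableAt ℝ Γ z)
    {b' c' d' : ℝ} (hb : HasDerivAt b b' z.1) (hc : HasDerivAt c c' z.1)
    (hd : HasDerivAt d d' z.1) (u w v : ℝ × E) :
    localCurvature Γ z u w v =
      ((b' + A * b z.1 - b z.1 * d z.1) * (u.1 * H z.2 w.2 v.2 - w.1 * H z.2 u.2 v.2),
        localCurvature (leviCivitaChristoffel H) z.2 u.2 w.2 v.2
          + (v.1 * (c' + d z.1 * c z.1 - c z.1 * A)) • (u.1 • w.2 - w.1 • u.2)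
          + (c z.1 * b z.1) • (H z.2 w.2 v.2 • u.2 - H z.2 u.2 v.2 • w.2)) := by
  have key (u v w : ℝ × E) : fderiv ℝ Γ z u v w =
        (b' * u.1 * H z.2 v.2 w.2 + b z.1 * fderiv ℝ H z.2 u.2 v.2 w.2,
        fderiv ℝ (leviCivitaChristoffel H) z.2 u.2 v.2 w.2 + (d' * u.1 * v.1) • w.2
          + (c' * u.1 * w.1) • v.2) := by
    obtain ⟨T, hT, hT'⟩ := hasFDerivAt_warpedChristoffel (A := A) hH hz hb hc hd v w
    rw [fderiv_clm_apply₂ hΓd, Filter.EventuallyEq.fderiv_eq (hΓ.mono fun y hy ↦ hy v w),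
      hT.fderiv, hT']
  simp only [localCurvature, key, hΓ.self_of_nhds]
  ext
  · simp only [warpedChristoffel, hH.fderiv_eq hz, map_add, map_smul, smul_eq_mul,
      Prod.fst_add, Prod.fst_sub]
    rw [hH.leviCivitaChristoffel_symm hz w.2 u.2, hH.symm z.2 hz w.2 u.2]
    ring
  · simp only [warpedChristoffel, map_add, map_smul,
      Prod.snd_add, Prod.snd_sub]
    rw [hH.leviCivitaChristoffel_symm hz w.2 u.2]
    module

/-- In the last factor, `1 - n` is the trace of `w ↦ H(w, v) u` minus that of `w ↦ H(u, v) w`; the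
`b'` group is the contribution of `w = ∂/∂t`. No mixed time-space terms arise. -/
theorem localRicci_of_eventuallyEq_warpedChristoffel (hH : IsLocalMetric U H) (hz : z.2 ∈ U)
    (hΓ : ∀ᶠ y in nhds z, ∀ u v, Γ y u v = warpedChristoffel A b c d H y u v)
    (hΓd : DifferentiableAt ℝ Γ z)
    {b' c' d' : ℝ} (hb : HasDerivAt b b' z.1) (hc : HasDerivAt c c' z.1)
    (hd : HasDerivAt d d' z.1) (u v : ℝ × E) :
    localRicci Γ z u v =
      u.1 * v.1 * (Module.finrank ℝ E * (c' + d z.1 * c z.1 - c z.1 * A))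
        + localRicci (leviCivitaChristoffel H) z.2 u.2 v.2
        + (-(b' + A * b z.1 - b z.1 * d z.1) + (1 - Module.finrank ℝ E) * (c z.1 * b z.1))
          * H z.2 u.2 v.2 := by
  have hR := localCurvature_of_eventuallyEq_warpedChristoffel hH hz hΓ hΓd hb hc hd
  have hop : LinearMap.snd ℝ ℝ E ∘ₗ localCurvatureOperator Γ z u v ∘ₗ LinearMap.inr ℝ ℝ E =
      localCurvatureOperator (leviCivitaChristoffel H) z.2 u.2 v.2
        + (v.1 * (c' + d z.1 * c z.1 - c z.1 * A) * u.1) • LinearMap.id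
        + (c z.1 * b z.1) • ((((H z.2).flip v.2 : E →L[ℝ] ℝ) : E →ₗ[ℝ] ℝ).smulRight u.2
          - H z.2 u.2 v.2 • LinearMap.id) := by
    ext w
    simp [hR, smul_smul]
  rw [localRicci_apply, LinearMap.trace_prod_eq_add, hop, localCurvatureOperator_apply, hR,
    localRicci_apply]
  simp only [map_add, map_smul, map_sub, LinearMap.trace_id, LinearMap.trace_smulRight, map_zero,
    zero_apply, ContinuousLinearMap.coe_coe, ContinuousLinearMap.flip_apply, smul_eq_mul]
  ring

theorem localScalarCurvature_of_eventuallyEq_warpedChristoffel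
    (hV : IsOpen V) (hf : ContDiffOn ℝ ∞ f V)
    (hpos : ∀ t ∈ V, 0 < f t) (hH : IsLocalMetric U H) (hz : z ∈ V ×ˢ U)
    (hΓ : ∀ᶠ y in nhds z, ∀ u v, Γ y u v = warpedChristoffel A b c d H y u v)
    (hΓd : DifferentiableAt ℝ Γ z)
    {b' c' d' : ℝ} (hb : HasDerivAt b b' z.1) (hc : HasDerivAt c c' z.1)
    (hd : HasDerivAt d d' z.1) :
    localScalarCurvature (localWarpedMetric f H) Γ z =
      -(Module.finrank ℝ E * (c' + d z.1 * c z.1 - c z.1 * A))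
        + ((f z.1) ^ 2)⁻¹ * (localScalarCurvature H (leviCivitaChristoffel H) z.2
          + Module.finrank ℝ E * (-(b' + A * b z.1 - b z.1 * d z.1)
            + (1 - Module.finrank ℝ E) * (c z.1 * b z.1))) := by
  set α : ℝ := Module.finrank ℝ E * (c' + d z.1 * c z.1 - c z.1 * A) with hα
  set β : ℝ := -(b' + A * b z.1 - b z.1 * d z.1)
            + (1 - Module.finrank ℝ E) * (c z.1 * b z.1) with hβ
  have hf0 := (hpos z.1 hz.1).ne'
  have hQH (u v : E) : H z.2 (localRicciOperator H (leviCivitaChristoffel H) z.2 u) v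
      = localRicci (leviCivitaChristoffel H) z.2 u v :=
    (localRicciOperator_eq_iff (hH.nondegenerate z.2 hz.2) _ u _).1 rfl v
  -- Ricci is block diagonal; raising an index costs `-1` in the time direction and `f⁻²` along the
  -- fibre.
  have hQ (u : ℝ × E) : localRicciOperator (localWarpedMetric f H) Γ z u =
      (-α * u.1, ((f z.1) ^ 2)⁻¹ • (localRicciOperator H (leviCivitaChristoffel H) z.2 u.2
        + β • u.2)) := by
    rw [localRicciOperator_eq_iff
      ((isLocalMetric_localWarpedMetric hV hf hpos hH).nondegenerate z hz)]
    intro v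
    rw [localRicci_of_eventuallyEq_warpedChristoffel hH hz.2 hΓ hΓd hb hc hd, ← hα, ← hβ,
      localWarpedMetric_apply]
    simp only [map_add, map_smul, add_apply, smul_apply, smul_eq_mul, hQH]
    field_simp
    ring
  have hop : LinearMap.snd ℝ ℝ E ∘ₗ localRicciOperator (localWarpedMetric f H) Γ z ∘ₗ
      LinearMap.inr ℝ ℝ E = ((f z.1) ^ 2)⁻¹ •
        (localRicciOperator H (leviCivitaChristoffel H) z.2 + β • LinearMap.id) := by
    ext u
    simp [hQ]
  rw [localScalarCurvature_eq_trace, LinearMap.trace_prod_eq_add, hop, hQ,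
    localScalarCurvature_eq_trace]
  simp only [map_add, map_smul, LinearMap.trace_id, smul_eq_mul]
  ring

end Curvature

theorem localScalarCurvature_quarterSymmetric_localWarpedMetric (hV : IsOpen V)
    (hf : ContDiffOn ℝ ∞ f V) (hpos : ∀ t ∈ V, 0 < f t) (hH : IsLocalMetric U H) {z : ℝ × E}
    (hz : z ∈ V ×ˢ U) (lam₁ lam₂ : ℝ) (hE : Module.finrank ℝ E = 3) :
    (f z.1) ^ 2 * localScalarCurvature (localWarpedMetric f H)
      (quarterSymmetricChristoffel lam₁ lam₂ (localWarpedMetric f H) (fun _ ↦ (1, 0))) z =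
      localScalarCurvature H (leviCivitaChristoffel H) z.2
        - 3 * (2 * deriv f z.1 ^ 2 + 2 * f z.1 * deriv (deriv f) z.1)
        + 9 / 2 * (lam₁ + lam₂) * (2 * f z.1 * deriv f z.1)
        + (3 * lam₁ ^ 2 + 3 * lam₂ ^ 2 - 12 * lam₁ * lam₂) * (f z.1) ^ 2 := by
  have hf0 := (hpos z.1 hz.1).ne'
  have hG := isLocalMetric_localWarpedMetric hV hf hpos hH
  have hfz := hf.contDiffAt (hV.mem_nhds hz.1)
  have hd₁ : HasDerivAt f (deriv f z.1) z.1 := (hfz.differentiableAt (by simp)).hasDerivAt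
  have hd₂ : HasDerivAt (deriv f) (deriv (deriv f) z.1) z.1 :=
    (((hf.deriv_of_isOpen (m := ∞) hV (by simp)).contDiffAt
      (hV.mem_nhds hz.1)).differentiableAt (by simp)).hasDerivAt
  have hΓd : DifferentiableAt ℝ (quarterSymmetricChristoffel lam₁ lam₂ (localWarpedMetric f H)
      (fun _ ↦ (1, 0))) z := by
    refine ContDiffAt.differentiableAt (n := ∞) ?_ (by simp)
    refine contDiffAt_of_forall_clm_apply₂ fun u v ↦ ?_
    simp only [quarterSymmetricChristoffel_apply]
    have h (u v : ℝ × E) : ContDiffAt ℝ ∞ (fun z ↦ localWarpedMetric f H z u v) z :=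
      ((hG.contDiffAt hz).clm_apply contDiffAt_const).clm_apply contDiffAt_const
    exact ((((hG.contDiffAt_leviCivitaChristoffel hz).clm_apply contDiffAt_const).clm_apply
      contDiffAt_const).add (((h _ _).smul contDiffAt_const).const_smul _)).sub
      (((h _ _).smul contDiffAt_const).const_smul _)
  have hΓ : ∀ᶠ y in nhds z, ∀ u v,
      quarterSymmetricChristoffel lam₁ lam₂ (localWarpedMetric f H) (fun _ ↦ (1, 0)) y u v =
      warpedChristoffel (lam₂ - lam₁) (fun t ↦ f t * deriv f t - lam₂ * f t ^ 2)
        (fun t ↦ deriv f t / f t - lam₁) (fun t ↦ deriv f t / f t) H y u v :=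
    Filter.eventually_of_mem (hG.isOpen.mem_nhds hz) fun y hy u v ↦
      quarterSymmetricChristoffel_localWarpedMetric hV hf hpos hH hy lam₁ lam₂ u v
  rw [localScalarCurvature_of_eventuallyEq_warpedChristoffel hV hf hpos hH hz hΓ hΓd
    ((hd₁.mul hd₂).sub ((hd₁.pow 2).const_mul lam₂)) ((hd₂.div hd₁ hf0).sub_const lam₁)
    (hd₂.div hd₁ hf0), hE]
  field_simp
  push_cast
  ring

end WarpedProductLocal

/-! ### Passing from manifolds to charts. -/

section Charts

theorem coe_extChartAt_opens_symm {I : TopologicalSpace.Opens ℝ} (t : I) {s : ℝ}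
    (hs : s ∈ (extChartAt 𝓘(ℝ, ℝ) t).target) :
    (((extChartAt 𝓘(ℝ, ℝ) t).symm s : I) : ℝ) = s :=
  (extChartAt 𝓘(ℝ, ℝ) t).right_inv hs

theorem extChartAt_opens_target {I : TopologicalSpace.Opens ℝ} (t : I) :
    (extChartAt 𝓘(ℝ, ℝ) t).target = I := by
  simp only [extChartAt, TopologicalSpace.Opens.chartAt_eq, OpenPartialHomeomorph.subtypeRestr_def,
    chartAt_self_eq]
  simp

theorem mfderiv_extChartAt_opens_symm {I : TopologicalSpace.Opens ℝ} (t : I) {s : ℝ} (hs : s ∈ I) :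
    mfderiv 𝓘(ℝ, ℝ) 𝓘(ℝ, ℝ) (extChartAt 𝓘(ℝ, ℝ) t).symm s = ContinuousLinearMap.id ℝ ℝ := by
  have ht : (extChartAt 𝓘(ℝ, ℝ) t).target ∈ nhds s := by
    rw [extChartAt_opens_target]
    exact I.isOpen.mem_nhds hs
  have hmd : MDifferentiableAt 𝓘(ℝ, ℝ) 𝓘(ℝ, ℝ) (extChartAt 𝓘(ℝ, ℝ) t).symm s :=
    ((contMDiffOn_extChartAt_symm (n := ∞) t).contMDiffAt ht).mdifferentiableAt (by simp)
  have h : writtenInExtChartAt 𝓘(ℝ, ℝ) 𝓘(ℝ, ℝ) s (extChartAt 𝓘(ℝ, ℝ) t).symm =ᶠ[nhds s] id :=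
    Filter.eventually_of_mem ht fun r hr ↦ coe_extChartAt_opens_symm t hr
  -- `mfderiv` is defined by a case split on differentiability.
  refine (if_pos hmd).trans ?_
  rw [modelWithCornersSelf_coe, Set.range_id, fderivWithin_univ]
  exact h.fderiv_eq.trans fderiv_id

variable {E : Type*} [NormedAddCommGroup E] [NormedSpace ℝ E]
  {H : Type*} [TopologicalSpace H] {J : ModelWithCorners ℝ E H} [J.Boundaryless]
  {F : Type*} [TopologicalSpace F] [ChartedSpace H F] [IsManifold J ∞ F]

omit [IsManifold J ∞ F] in
theorem metricInChart_apply
    (g : ∀ x : F, TangentSpace J x →L[ℝ] TangentSpace J x →L[ℝ] ℝ) (p : F) (y u v : E) :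
    metricInChart J g p y u v = g ((extChartAt J p).symm y)
      (mfderiv 𝓘(ℝ, E) J (extChartAt J p).symm y u)
      (mfderiv 𝓘(ℝ, E) J (extChartAt J p).symm y v) := by
  rw [metricInChart, J.range_eq_univ, mfderivWithin_univ]
  rfl

theorem mdifferentiableAt_extChartAt_symm {p : F} {y : E} (hy : y ∈ (extChartAt J p).target) :
    MDifferentiableAt 𝓘(ℝ, E) J (extChartAt J p).symm y :=
  ((contMDiffOn_extChartAt_symm (n := ∞) p).contMDiffAt
    ((isOpen_extChartAt_target p).mem_nhds hy)).mdifferentiableAt (by simp)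

theorem isInvertible_mfderiv_extChartAt_symm {p : F} {y : E}
    (hy : y ∈ (extChartAt J p).target) :
    (mfderiv 𝓘(ℝ, E) J (extChartAt J p).symm y).IsInvertible := by
  have : IsManifold J 1 F := IsManifold.of_le (n := ∞) (by simp)
  simpa [J.range_eq_univ, mfderivWithin_univ] using
    isInvertible_mfderivWithin_extChartAt_symm (I := J) hy

theorem isLocalMetric_metricInChart [FiniteDimensional ℝ E]
    {g : ∀ x : F, TangentSpace J x →L[ℝ] TangentSpace J x →L[ℝ] ℝ}
    (hg : IsPseudoRiemannianMetric J g) (p : F) :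
    IsLocalMetric (extChartAt J p).target (metricInChart J g p) where
  isOpen := isOpen_extChartAt_target p
  symm y _ v w := by
    rw [metricInChart_apply, metricInChart_apply, hg.symm]
  nondegenerate y hy v hv := by
    obtain ⟨e, he⟩ := isInvertible_mfderiv_extChartAt_symm hy
    have h : mfderiv 𝓘(ℝ, E) J (extChartAt J p).symm y v = 0 := by
      refine hg.nondegenerate _ _ fun w ↦ ?_
      have h := (metricInChart_apply g p y v (e.symm w)).symm.trans (hv (e.symm w))
      rw [← he] at h ⊢
      rw [← e.apply_symm_apply w]
      exact h
    rw [← he] at h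
    exact e.map_eq_zero_iff.1 h
  contDiffOn y hy := by
    have : IsManifold J 1 F := IsManifold.of_le (n := ∞) (by simp)
    refine ContDiffAt.contDiffWithinAt (contDiffAt_of_forall_clm_apply₂ fun v w ↦ ?_)
    simp only [metricInChart_apply]
    rw [← contMDiffAt_iff_contDiffAt]
    have hφ : ContMDiffOn 𝓘(ℝ, E) J ∞ (extChartAt J p).symm (extChartAt J p).target :=
      contMDiffOn_extChartAt_symm (n := ∞) p
    -- The coordinate field `v` is the tangent map of the inverse chart applied to a constant
    -- section.
    have hvec (v : E) : ContMDiffAt 𝓘(ℝ, E) (J.prod 𝓘(ℝ, E)) ∞ (fun z ↦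
        (⟨(extChartAt J p).symm z, mfderiv 𝓘(ℝ, E) J (extChartAt J p).symm z v⟩ :
          TangentBundle J F)) y := by
      have h₁ := hφ.contMDiffOn_tangentMapWithin (m := ∞) (by simp)
        (isOpen_extChartAt_target p).uniqueMDiffOn
      have h₂ : ContMDiffOn 𝓘(ℝ, E) 𝓘(ℝ, E).tangent ∞
          (fun z ↦ (⟨z, v⟩ : TangentBundle 𝓘(ℝ, E) E)) (extChartAt J p).target :=
        contMDiffOn_vectorSpace_iff_contDiffOn.2 contDiffOn_const
      refine ((h₁.comp h₂ fun z hz ↦ hz).congr fun z hz ↦ ?_).contMDiffAt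
        ((isOpen_extChartAt_target p).mem_nhds hy)
      simp only [tangentMapWithin, Function.comp_apply]
      rw [mfderivWithin_of_isOpen (isOpen_extChartAt_target p) hz]
    have h : ContMDiffAt 𝓘(ℝ, E) (J.prod 𝓘(ℝ)) ∞ (fun z ↦
        Bundle.TotalSpace.mk' ℝ (E := Bundle.Trivial F ℝ) ((extChartAt J p).symm z)
          (g ((extChartAt J p).symm z) (mfderiv 𝓘(ℝ, E) J (extChartAt J p).symm z v)
            (mfderiv 𝓘(ℝ, E) J (extChartAt J p).symm z w))) y := by
      apply ContMDiffAt.clm_bundle_apply₂ (F₁ := E) (F₂ := E)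
      · exact hg.contMDiff.contMDiffAt.comp y
          (hφ.contMDiffAt ((isOpen_extChartAt_target p).mem_nhds hy))
      · exact hvec v
      · exact hvec w
    simp only [Bundle.contMDiffAt_totalSpace] at h
    exact h.2

end Charts

/-! ### The warped product in a product chart. -/

section WarpedProductCharts

variable {E : Type*} [NormedAddCommGroup E] [NormedSpace ℝ E]
  {H : Type*} [TopologicalSpace H] {J : ModelWithCorners ℝ E H} [J.Boundaryless]
  {F : Type*} [TopologicalSpace F] [ChartedSpace H F] [IsManifold J ∞ F]
  {I : TopologicalSpace.Opens ℝ}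

theorem mfderiv_extChartAt_symm_prod (p : I × F) {z : ℝ × E} (hz₁ : z.1 ∈ I)
    (hz₂ : z.2 ∈ (extChartAt J p.2).target) :
    mfderiv 𝓘(ℝ, ℝ × E) (𝓘(ℝ, ℝ).prod J) (extChartAt (𝓘(ℝ, ℝ).prod J) p).symm z =
      (ContinuousLinearMap.id ℝ ℝ).prodMap
        (mfderiv 𝓘(ℝ, E) J (extChartAt J p.2).symm z.2) := by
  have h := mfderiv_prodMap
    (mdifferentiableAt_extChartAt_symm (J := 𝓘(ℝ, ℝ)) (p := p.1)
      (by rwa [extChartAt_opens_target])) (mdifferentiableAt_extChartAt_symm hz₂)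
  rw [mfderiv_extChartAt_opens_symm p.1 hz₁] at h
  rw [extChartAt_prod, modelWithCornersSelf_prod, ← chartedSpaceSelf_prod]
  exact h

omit [J.Boundaryless] [IsManifold J ∞ F] in
theorem warpedMetric_apply (f : ℝ → ℝ)
    (g : ∀ x : F, TangentSpace J x →L[ℝ] TangentSpace J x →L[ℝ] ℝ) (p : I × F) (u v : ℝ × E) :
    warpedMetric J I f g p u v = -(u.1 * v.1) + f p.1 ^ 2 * g p.2 u.2 v.2 := rfl

theorem metricInChart_warpedMetric (f : ℝ → ℝ)
    (g : ∀ x : F, TangentSpace J x →L[ℝ] TangentSpace J x →L[ℝ] ℝ) (p : I × F) {z : ℝ × E}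
    (hz₁ : z.1 ∈ I) (hz₂ : z.2 ∈ (extChartAt J p.2).target) :
    metricInChart (𝓘(ℝ, ℝ).prod J) (warpedMetric J I f g) p z =
      localWarpedMetric f (metricInChart J g p.2) z := by
  refine ContinuousLinearMap.ext fun u ↦ ContinuousLinearMap.ext fun v ↦ ?_
  rw [metricInChart_apply, mfderiv_extChartAt_symm_prod p hz₁ hz₂, localWarpedMetric_apply,
    metricInChart_apply]
  have h : (((extChartAt (𝓘(ℝ, ℝ).prod J) p).symm z).1 : ℝ) = z.1 :=
    coe_extChartAt_opens_symm p.1 (by rwa [extChartAt_opens_target])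
  rw [← h]
  exact warpedMetric_apply f g _ _ _

theorem vectorFieldInChart_timeField (p : I × F) {z : ℝ × E} (hz₁ : z.1 ∈ I)
    (hz₂ : z.2 ∈ (extChartAt J p.2).target) :
    vectorFieldInChart (𝓘(ℝ, ℝ).prod J) (timeField J I) p z = (1, 0) := by
  rw [vectorFieldInChart, VectorField.mpullbackWithin_apply, ModelWithCorners.range_eq_univ,
    mfderivWithin_univ, mfderiv_extChartAt_symm_prod p hz₁ hz₂]
  -- The pullback uses the inverse of `id × e`, which fixes `(1, 0)`.
  obtain ⟨e, he⟩ := isInvertible_mfderiv_extChartAt_symm hz₂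
  rw [← he]
  exact (congrArg (fun A : ℝ × E →L[ℝ] ℝ × E ↦ A (1, 0)) (ContinuousLinearMap.inverse_equiv
    ((ContinuousLinearEquiv.refl ℝ ℝ).prodCongr (e : E ≃L[ℝ] E)))).trans
    (Prod.ext rfl (map_zero (e : E ≃L[ℝ] E).symm))

end WarpedProductCharts

theorem sq_mul_quarterSymmetricScalarCurvature_warpedMetric
    {E : Type*} [NormedAddCommGroup E] [NormedSpace ℝ E] [FiniteDimensional ℝ E]
    {H : Type*} [TopologicalSpace H] {J : ModelWithCorners ℝ E H} [J.Boundaryless]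
    {F : Type*} [TopologicalSpace F] [ChartedSpace H F] [IsManifold J ∞ F]
    {I : TopologicalSpace.Opens ℝ} {f : ℝ → ℝ} (hf : ContDiffOn ℝ ∞ f I)
    (hpos : ∀ t ∈ I, 0 < f t)
    {g : ∀ x : F, TangentSpace J x →L[ℝ] TangentSpace J x →L[ℝ] ℝ}
    (hg : IsPseudoRiemannianMetric J g) (hE : Module.finrank ℝ E = 3) (lam₁ lam₂ : ℝ)
    (p : I × F) :
    (f p.1) ^ 2 * quarterSymmetricScalarCurvature (𝓘(ℝ, ℝ).prod J) lam₁ lam₂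
        (warpedMetric J I f g) (timeField J I) p =
      scalarCurvature J g p.2
        - 3 * (2 * deriv f p.1 ^ 2 + 2 * f p.1 * deriv (deriv f) p.1)
        + 9 / 2 * (lam₁ + lam₂) * (2 * f p.1 * deriv f p.1)
        + (3 * lam₁ ^ 2 + 3 * lam₂ ^ 2 - 12 * lam₁ * lam₂) * (f p.1) ^ 2 := by
  have hH := isLocalMetric_metricInChart hg p.2
  have hz : ((p.1 : ℝ), extChartAt J p.2 p.2) ∈ (I : Set ℝ) ×ˢ (extChartAt J p.2).target :=
    ⟨p.1.2, mem_extChartAt_target p.2⟩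
  have hnhds := (I.isOpen.prod hH.isOpen).mem_nhds hz
  have hG : metricInChart (𝓘(ℝ, ℝ).prod J) (warpedMetric J I f g) p =ᶠ[nhds (p.1.1, _)]
      localWarpedMetric f (metricInChart J g p.2) :=
    Filter.eventually_of_mem hnhds fun z hz ↦ metricInChart_warpedMetric f g p hz.1 hz.2
  have hP : vectorFieldInChart (𝓘(ℝ, ℝ).prod J) (timeField J I) p =ᶠ[nhds (p.1.1, _)]
      fun _ ↦ (1, 0) :=
    Filter.eventually_of_mem hnhds fun z hz ↦ vectorFieldInChart_timeField p hz.1 hz.2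
  have hp : extChartAt (𝓘(ℝ, ℝ).prod J) p p = ((p.1 : ℝ), extChartAt J p.2 p.2) := by
    rw [extChartAt_prod]
    rfl
  rw [quarterSymmetricScalarCurvature, hp, localScalarCurvature_congr hG.self_of_nhds
    (quarterSymmetricChristoffel_congr lam₁ lam₂ hG hP)]
  exact localScalarCurvature_quarterSymmetric_localWarpedMetric I.isOpen hf hpos hH hz lam₁ lam₂ hE

end

theorem theorem3p19 (I : TopologicalSpace.Opens ℝ) (hIne : (I : Set ℝ).Nonempty)
    (hIconn : (I : Set ℝ).OrdConnected)
    (f : ℝ → ℝ) (hf : ContDiffOn ℝ ∞ f I) (hfpos : ∀ t ∈ I, 0 < f t)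
    {F : Type*} [TopologicalSpace F] [Nonempty F] [ChartedSpace (EuclideanSpace ℝ (Fin 3)) F]
    [IsManifold (𝓡 3) ∞ F]
    (gF : ∀ x : F, TangentSpace (𝓡 3) x →L[ℝ] TangentSpace (𝓡 3) x →L[ℝ] ℝ)
    (hgF : IsPseudoRiemannianMetric (𝓡 3) gF)
    (lam₁ lam₂ S : ℝ) :
    (∀ p : I × F, quarterSymmetricScalarCurvature (𝓘(ℝ, ℝ).prod (𝓡 3)) lam₁ lam₂
        (warpedMetric (𝓡 3) I f gF) (timeField (𝓡 3) I) p = S) ↔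
    ∃ SF : ℝ, (∀ x : F, scalarCurvature (𝓡 3) gF x = SF) ∧
      ((S < 27 / 16 * (lam₁ + lam₂) ^ 2 + 3 * lam₁ ^ 2 + 3 * lam₂ ^ 2 - 12 * lam₁ * lam₂ ∧
          S ≠ 3 * lam₁ ^ 2 + 3 * lam₂ ^ 2 - 12 * lam₁ * lam₂ ∧
          ∃ c₁ c₂ : ℝ, ∀ t ∈ I, f t ^ 2 =
            c₁ * Real.exp ((3 / 2 * (lam₁ + lam₂) + √(9 / 4 * (lam₁ + lam₂) ^ 2 - 4 / 3 * S
              + 4 * lam₁ ^ 2 + 4 * lam₂ ^ 2 - 16 * lam₁ * lam₂)) / 2 * t)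
            + c₂ * Real.exp ((3 / 2 * (lam₁ + lam₂) - √(9 / 4 * (lam₁ + lam₂) ^ 2 - 4 / 3 * S
              + 4 * lam₁ ^ 2 + 4 * lam₂ ^ 2 - 16 * lam₁ * lam₂)) / 2 * t)
            + SF / (12 * lam₁ * lam₂ - 3 * lam₁ ^ 2 - 3 * lam₂ ^ 2 + S)) ∨
       (S = 27 / 16 * (lam₁ + lam₂) ^ 2 + 3 * lam₁ ^ 2 + 3 * lam₂ ^ 2 - 12 * lam₁ * lam₂ ∧
          S ≠ 3 * lam₁ ^ 2 + 3 * lam₂ ^ 2 - 12 * lam₁ * lam₂ ∧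
          ∃ c₁ c₂ : ℝ, ∀ t ∈ I, f t ^ 2 =
            c₁ * Real.exp (3 / 4 * (lam₁ + lam₂) * t)
            + c₂ * t * Real.exp (3 / 4 * (lam₁ + lam₂) * t)
            + SF / (12 * lam₁ * lam₂ - 3 * lam₁ ^ 2 - 3 * lam₂ ^ 2 + S)) ∨
       (27 / 16 * (lam₁ + lam₂) ^ 2 + 3 * lam₁ ^ 2 + 3 * lam₂ ^ 2 - 12 * lam₁ * lam₂ < S ∧
          ∃ c₁ c₂ : ℝ, ∀ t ∈ I, f t ^ 2 =
            c₁ * Real.exp (3 / 4 * (lam₁ + lam₂) * t)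
              * Real.cos (√(4 / 3 * S - 4 * lam₁ ^ 2 - 4 * lam₂ ^ 2 + 16 * lam₁ * lam₂
                - 9 / 4 * (lam₁ + lam₂) ^ 2) / 2 * t)
            + c₂ * Real.exp (3 / 4 * (lam₁ + lam₂) * t)
              * Real.sin (√(4 / 3 * S - 4 * lam₁ ^ 2 - 4 * lam₂ ^ 2 + 16 * lam₁ * lam₂
                - 9 / 4 * (lam₁ + lam₂) ^ 2) / 2 * t)
            + SF / (12 * lam₁ * lam₂ - 3 * lam₁ ^ 2 - 3 * lam₂ ^ 2 + S)) ∨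
       (S = 3 * lam₁ ^ 2 + 3 * lam₂ ^ 2 - 12 * lam₁ * lam₂ ∧ lam₁ + lam₂ ≠ 0 ∧
          ∃ c₁ c₂ : ℝ, ∀ t ∈ I, f t ^ 2 =
            c₁ - 2 * SF / (9 * (lam₁ + lam₂)) * t + c₂ * Real.exp (3 / 2 * (lam₁ + lam₂) * t)) ∨
       (S = 3 * lam₁ ^ 2 + 3 * lam₂ ^ 2 - 12 * lam₁ * lam₂ ∧ lam₁ + lam₂ = 0 ∧
          ∃ c₁ c₂ : ℝ, ∀ t ∈ I, f t ^ 2 = SF / 6 * t ^ 2 + c₁ * t + c₂)) := by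
  have hd₁ (t : ℝ) (ht : t ∈ (I : Set ℝ)) : HasDerivAt f (deriv f t) t :=
    ((hf.contDiffAt (I.isOpen.mem_nhds ht)).differentiableAt (by simp)).hasDerivAt
  have hd₂ (t : ℝ) (ht : t ∈ (I : Set ℝ)) : HasDerivAt (deriv f) (deriv (deriv f) t) t :=
    (((hf.deriv_of_isOpen (m := ∞) I.isOpen (by simp)).contDiffAt
      (I.isOpen.mem_nhds ht)).differentiableAt (by simp)).hasDerivAt
  have hv (t : ℝ) (ht : t ∈ (I : Set ℝ)) :
      HasDerivAt (fun t ↦ f t ^ 2) (2 * f t * deriv f t) t :=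
    ((hd₁ t ht).pow 2).congr_deriv (by simp)
  have hv' (t : ℝ) (ht : t ∈ (I : Set ℝ)) : HasDerivAt (fun t ↦ 2 * f t * deriv f t)
      (2 * deriv f t ^ 2 + 2 * f t * deriv (deriv f) t) t :=
    (((hd₁ t ht).const_mul 2).mul (hd₂ t ht)).congr_deriv (by ring)
  have hcurv := sq_mul_quarterSymmetricScalarCurvature_warpedMetric hf hfpos hgF
    (by simp) lam₁ lam₂
  have key (p : I × F) : quarterSymmetricScalarCurvature (𝓘(ℝ, ℝ).prod (𝓡 3)) lam₁ lam₂
        (warpedMetric (𝓡 3) I f gF) (timeField (𝓡 3) I) p = S ↔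
      2 * deriv f p.1 ^ 2 + 2 * f p.1 * deriv (deriv f) p.1 =
        3 / 2 * (lam₁ + lam₂) * (2 * f p.1 * deriv f p.1)
        - (S - (3 * lam₁ ^ 2 + 3 * lam₂ ^ 2 - 12 * lam₁ * lam₂)) / 3 * f p.1 ^ 2
        + scalarCurvature (𝓡 3) gF p.2 / 3 := by
    have hf0 : f p.1 ^ 2 ≠ 0 := pow_ne_zero 2 (hfpos p.1 p.1.2).ne'
    rw [← mul_right_inj' hf0, hcurv p]
    constructor <;> intro h
    · linear_combination (-1 / 3) * h
    · linear_combination (-3) * h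
  have hode (SF : ℝ) := warping_ode_iff I.isOpen hIconn.isPreconnected hIne hv hv' lam₁ lam₂ S SF
  obtain ⟨t₀, ht₀⟩ := hIne
  obtain ⟨x₀⟩ := ‹Nonempty F›
  constructor
  · intro h
    -- Separation of variables: at the fixed time `t₀` every term except the fibre curvature is
    -- independent of `x`.
    have hconst (x : F) : scalarCurvature (𝓡 3) gF x = scalarCurvature (𝓡 3) gF x₀ := by
      have h₁ := (key (⟨t₀, ht₀⟩, x)).1 (h _)
      have h₂ := (key (⟨t₀, ht₀⟩, x₀)).1 (h _)
      linear_combination 3 * h₂ - 3 * h₁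
    exact ⟨_, hconst, (hode _).1 fun t ht ↦ (key (⟨t, ht⟩, x₀)).1 (h _)⟩
  · rintro ⟨SF, hSF, h⟩ p
    rw [key p, hSF]
    exact (hode SF).2 h p.1 p.1.2
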